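/- **Setting.** Let $d\in\{2,3\}$, let $\Omega\subset\mathbb R^d$ be a bounded open set, and let $c_{02}>0$, $c_{21}>0$, $c_{21}+c_{22}>0$. Let $\mathcal Q$ be the space of symmetric traceless real $3\times3$ matrices, $\mathcal Q_{\rm phys}\subset\mathcal Q$ the set of those with all eigenvalues in $(-\tfrac13,\tfrac23)$, $(\mathscr P A)_{ij}=\tfrac12(A_{ij}+A_{ji})-\tfrac13\delta_{ij}A_{kk}$ (repeated indices are summed over $1,2,3$; $\partial_3=0$ if $d=2$), and $$q(Q)=-\ln\det\bigl(Q+\tfrac13I\bigr)-2\ln\det\bigl(\tfrac13I-\tfrac12Q\bigr)\quad\text{on }\mathcal Q_{\rm phys},$$ $$(\mathcal L Q)_{ij}=c_{21}\Delta Q_{ij}+\tfrac{c_{22}}2\bigl(\partial_{ik}Q_{kj}+\partial_{jk}Q_{ki}-\tfrac23\partial_{kl}Q_{kl}\delta_{ij}\bigr).$$ Write $\|\cdot\|$ for the norm of $L^2(\Omega)$, with $|A|^2=A_{ij}A_{ij}$. The boundary datum is that of a field $G\in H^1(\Omega)$; "$Q=G$ on $\partial\Omega$" means $Q-G\in H^1_0(\Omega)$.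 All spatial equations below are for fields in $H^1(\Omega)$ with values in $\mathcal Q_{\rm phys}$ a.e., and are understood weakly: for every tensor-valued test field $\varphi\in H^1_0(\Omega)\cap L^\infty(\Omega)$ the function $\mathscr P(\partial q/\partial Q)\cdot\varphi$ is integrable, and the equation holds after multiplication by $\varphi$, integration over $\Omega$, and integration by parts in $\mathcal L$. Let $T>0$ and let $Q\in C([0,T];L^2(\Omega))$ have weak time derivatives $\partial_tQ,\partial_{tt}Q\in L^2(0,T;L^2(\Omega))$ and satisfy, for a.e. $t\in(0,T)$, $$\partial_tQ=-\mathscr P\frac{\partial q}{\partial Q}+c_{02}Q+\mathcal LQ\ \text{ in }\Omega,\qquad Q=G\ \text{ on }\partial\Omega .$$ Let $\delta t>0$, $N\in\mathbb N$, $N\delta t\le T$, $t^n=n\,\delta t$, and let $Q^0=Q(\cdot,0)$ and $Q^1,\dots,Q^N$ satisfy the first-order scheme $$\frac{Q^{n+1}-Q^n}{\delta t}=-\mathscr P\frac{\partial q}{\partial Q^{n+1}}+c_{02}Q^n+\mathcal LQ^{n+1}\ \text{ in }\Omega,\qquad Q^{n+1}=G\ \text{ on }\partial\Omega,\qquad 0\le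 n<N .$$ Put $R^n=Q^n-Q(\cdot,t^n)$. **Theorem.** There is an absolute constant $K>0$ (independent of $d$, $\Omega$, $c_{02},c_{21},c_{22}$, $G$, $T$, $Q$, $\delta t$, $N$ and the scheme) such that, with $C=K(1+c_{02})$, whenever $C\,\delta t<1$, $$\|R^n\|^2\le C\exp\!\Bigl(\frac{C\,t^n}{1-C\,\delta t}\Bigr)\,\delta t^2\int_0^{t^n}\bigl(\|\partial_tQ\|^2+\|\partial_{tt}Q\|^2\bigr)\,dt\qquad\text{for all }0\le n\le N .$$ In particular the scheme is first order in time. -/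

import Mathlib

open MeasureTheory Filter Topology
open scoped ContDiff ENNReal

noncomputable section

namespace QTensor

/-! ### Tensors -/

/-- Second-order tensors (real `3 × 3` matrices) with the dot product `A · B = ∑ i j, A i j * B i j`
as inner product, so that `‖A‖ ^ 2 = |A| ^ 2`. The `(i, j)` component of `A` is `A (i, j)`. -/
abbrev Tensor : Type := EuclideanSpace ℝ (Fin 3 × Fin 3)

/-- A tensor as a matrix. -/
def toMat (A : Tensor) : Matrix (Fin 3) (Fin 3) ℝ := Matrix.of fun i j => A (i, j)

/-- A matrix as a tensor. -/
def ofMat (M : Matrix (Fin 3) (Fin 3) ℝ) : Tensor := WithLp.toLp 2 fun p => M p.1 p.2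

/-- The projection onto the symmetric traceless tensors,
`(P A) i j = (A i j + A j i) / 2 - δ i j * tr A / 3`. -/
def proj (A : Tensor) : Tensor :=
  WithLp.toLp 2 fun p =>
    (A (p.1, p.2) + A (p.2, p.1)) / 2 - (if p.1 = p.2 then (∑ k, A (k, k)) / 3 else 0)

/-- The physical tensors: symmetric, traceless, all eigenvalues in `(-1/3, 2/3)`. -/
def physical : Set Tensor :=
  {A | (toMat A).IsSymm ∧ (toMat A).trace = 0 ∧
    ∀ μ ∈ spectrum ℝ (toMat A), μ ∈ Set.Ioo (-1 / 3 : ℝ) (2 / 3)}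

/-- The quasi-entropy `q(A) = - ln det (A + I/3) - 2 ln det (I/3 - A/2)`. It is only used on
`physical`, where both determinants are positive. -/
def quasiEntropy (A : Tensor) : ℝ :=
  -Real.log (toMat A + (1 / 3 : ℝ) • (1 : Matrix (Fin 3) (Fin 3) ℝ)).det
    - 2 * Real.log ((1 / 3 : ℝ) • (1 : Matrix (Fin 3) (Fin 3) ℝ) - (1 / 2 : ℝ) • toMat A).det

/-- `∂q/∂A`, the derivative of the quasi-entropy with respect to the nine components of `A`. -/
def quasiEntropyGrad (A : Tensor) : Tensor := gradient quasiEntropy A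

lemma det_add_ne_zero {A : Tensor} (hA : A ∈ physical) :
    (toMat A + (1 / 3 : ℝ) • (1 : Matrix (Fin 3) (Fin 3) ℝ)).det ≠ 0 := by
  intro h
  have hs : (-1 / 3 : ℝ) ∈ spectrum ℝ (toMat A) := by
    rw [spectrum.mem_iff, Matrix.isUnit_iff_isUnit_det, Algebra.algebraMap_eq_smul_one]
    have : (-1 / 3 : ℝ) • (1 : Matrix (Fin 3) (Fin 3) ℝ) - toMat A =
        -(toMat A + (1 / 3 : ℝ) • (1 : Matrix (Fin 3) (Fin 3) ℝ)) := by
      module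
    rw [this, Matrix.det_neg, h]
    simp
  exact lt_irrefl _ (hA.2.2 _ hs).1

lemma det_sub_ne_zero {A : Tensor} (hA : A ∈ physical) :
    ((1 / 3 : ℝ) • (1 : Matrix (Fin 3) (Fin 3) ℝ) - (1 / 2 : ℝ) • toMat A).det ≠ 0 := by
  intro h
  have hs : (2 / 3 : ℝ) ∈ spectrum ℝ (toMat A) := by
    rw [spectrum.mem_iff, Matrix.isUnit_iff_isUnit_det, Algebra.algebraMap_eq_smul_one]
    have : (2 / 3 : ℝ) • (1 : Matrix (Fin 3) (Fin 3) ℝ) - toMat A =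
        (2 : ℝ) • ((1 / 3 : ℝ) • (1 : Matrix (Fin 3) (Fin 3) ℝ) - (1 / 2 : ℝ) • toMat A) := by
      module
    rw [this, Matrix.det_smul, h]
    simp
  exact lt_irrefl _ (hA.2.2 _ hs).2

lemma hasDerivAt_det (M H : Matrix (Fin 3) (Fin 3) ℝ) :
    HasDerivAt (fun s : ℝ => (M + s • H).det) (M.adjugate * H).trace 0 := by
  have h : ∀ i j, HasDerivAt (fun s : ℝ => (M + s • H) i j) (H i j) 0 := fun i j => by
    simpa using ((hasDerivAt_id (0 : ℝ)).mul_const (H i j)).const_add (M i j)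
  simp only [Matrix.det_fin_three]
  have := ((((((h 0 0).mul (h 1 1)).mul (h 2 2)).sub (((h 0 0).mul (h 1 2)).mul (h 2 1))).sub
    (((h 0 1).mul (h 1 0)).mul (h 2 2))).add (((h 0 1).mul (h 1 2)).mul (h 2 0))).add
    (((h 0 2).mul (h 1 0)).mul (h 2 1)) |>.sub (((h 0 2).mul (h 1 1)).mul (h 2 0))
  refine this.congr_deriv ?_
  simp only [Matrix.adjugate_fin_three, Matrix.trace_fin_three, Matrix.mul_apply,
    Fin.sum_univ_three, Pi.mul_apply, zero_smul, add_zero]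
  simp
  ring

lemma differentiableAt_det {f : Tensor → Matrix (Fin 3) (Fin 3) ℝ} {A : Tensor}
    (hf : ∀ i j, DifferentiableAt ℝ (fun B => f B i j) A) :
    DifferentiableAt ℝ (fun B => (f B).det) A := by
  simp only [Matrix.det_fin_three]
  have := hf
  fun_prop

/-- The explicit formula `∂q/∂A = - (A + I/3)⁻¹ + (I/3 - A/2)⁻¹` at a physical tensor. -/
theorem quasiEntropyGrad_eq {A : Tensor} (hA : A ∈ physical) :
    quasiEntropyGrad A =
      ofMat (-(toMat A + (1 / 3 : ℝ) • (1 : Matrix (Fin 3) (Fin 3) ℝ))⁻¹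
        + ((1 / 3 : ℝ) • (1 : Matrix (Fin 3) (Fin 3) ℝ) - (1 / 2 : ℝ) • toMat A)⁻¹) := by
  set M := toMat A + (1 / 3 : ℝ) • (1 : Matrix (Fin 3) (Fin 3) ℝ) with hM
  set N := (1 / 3 : ℝ) • (1 : Matrix (Fin 3) (Fin 3) ℝ) - (1 / 2 : ℝ) • toMat A with hN
  have hMd : M.det ≠ 0 := det_add_ne_zero hA
  have hNd : N.det ≠ 0 := det_sub_ne_zero hA
  have hMs : M⁻¹.IsSymm := by
    have : M.IsSymm := by
      rw [Matrix.IsSymm, hM, Matrix.transpose_add, hA.1.eq]; simp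
    rw [Matrix.IsSymm, Matrix.transpose_nonsing_inv, this.eq]
  have hNs : N⁻¹.IsSymm := by
    have : N.IsSymm := by
      rw [Matrix.IsSymm, hN, Matrix.transpose_sub, Matrix.transpose_smul, Matrix.transpose_smul,
        hA.1.eq]; simp
    rw [Matrix.IsSymm, Matrix.transpose_nonsing_inv, this.eq]
  have hd : DifferentiableAt ℝ quasiEntropy A := by
    unfold quasiEntropy
    have d1 : DifferentiableAt ℝ (fun B : Tensor =>
        (toMat B + (1 / 3 : ℝ) • (1 : Matrix (Fin 3) (Fin 3) ℝ)).det) A := by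
      refine differentiableAt_det fun i j => ?_
      simp only [Matrix.add_apply, toMat, Matrix.of_apply]
      fun_prop
    have d2 : DifferentiableAt ℝ (fun B : Tensor =>
        ((1 / 3 : ℝ) • (1 : Matrix (Fin 3) (Fin 3) ℝ) - (1 / 2 : ℝ) • toMat B).det) A := by
      refine differentiableAt_det fun i j => ?_
      simp only [Matrix.sub_apply, Matrix.smul_apply, toMat, Matrix.of_apply]
      fun_prop
    exact (d1.log hMd).neg.sub ((d2.log hNd).const_mul 2)
  refine ext_inner_right ℝ fun H => ?_
  have h1 : HasDerivAt (fun s : ℝ => quasiEntropy (A + s • H))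
      (inner ℝ (quasiEntropyGrad A) H) 0 := by
    have hg := hd.hasGradientAt.hasFDerivAt
    have hl : HasDerivAt (fun s : ℝ => A + s • H) H 0 := by
      simpa using ((hasDerivAt_id (0 : ℝ)).smul_const H).const_add A
    have hA0 : A = A + (0 : ℝ) • H := by simp
    rw [hA0] at hg
    have := hg.comp_hasDerivAt (0 : ℝ) hl
    simpa [quasiEntropyGrad, Function.comp_def] using this
  have e1 : ∀ s : ℝ, toMat (A + s • H) + (1 / 3 : ℝ) • (1 : Matrix (Fin 3) (Fin 3) ℝ) =
      M + s • toMat H := fun s => by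
    ext i j; simp [hM, toMat]; ring
  have e2 : ∀ s : ℝ, (1 / 3 : ℝ) • (1 : Matrix (Fin 3) (Fin 3) ℝ) - (1 / 2 : ℝ) • toMat (A + s • H)
      = N + s • ((-1 / 2 : ℝ) • toMat H) := fun s => by
    ext i j; simp [hN, toMat]; ring
  have h2 : HasDerivAt (fun s : ℝ => quasiEntropy (A + s • H))
      (-((M.adjugate * toMat H).trace / M.det)
        - 2 * ((N.adjugate * ((-1 / 2 : ℝ) • toMat H)).trace / N.det)) 0 := by
    simp only [quasiEntropy, e1, e2]
    have a1 := (hasDerivAt_det M (toMat H)).log (by simpa using hMd)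
    have a2 := (hasDerivAt_det N ((-1 / 2 : ℝ) • toMat H)).log (by simpa using hNd)
    refine (a1.neg.sub (a2.const_mul 2)).congr_deriv ?_
    simp
  rw [h1.unique h2]
  have t1 : (M.adjugate * toMat H).trace / M.det = (M⁻¹ * toMat H).trace := by
    rw [Matrix.inv_def, Ring.inverse_eq_inv', Matrix.smul_mul, Matrix.trace_smul, smul_eq_mul]
    ring
  have t2 : (N.adjugate * ((-1 / 2 : ℝ) • toMat H)).trace / N.det =
      -1 / 2 * (N⁻¹ * toMat H).trace := by
    rw [Matrix.inv_def N, Ring.inverse_eq_inv', Matrix.smul_mul, Matrix.mul_smul,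
      Matrix.trace_smul, Matrix.trace_smul, smul_eq_mul, smul_eq_mul]
    ring
  have key : ∀ K : Matrix (Fin 3) (Fin 3) ℝ, K.IsSymm →
      (K * toMat H).trace = ∑ p : Fin 3 × Fin 3, K p.1 p.2 * H p := fun K hK => by
    rw [Fintype.sum_prod_type]
    simp only [Matrix.trace, Matrix.diag, Matrix.mul_apply, toMat, Matrix.of_apply]
    rw [Finset.sum_comm]
    refine Finset.sum_congr rfl fun i _ => Finset.sum_congr rfl fun j _ => ?_
    rw [hK.apply]
  rw [t1, t2, key _ hMs, key _ hNs]
  simp only [PiLp.inner_apply, ofMat, Matrix.add_apply, Matrix.neg_apply]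
  have : ∀ p : Fin 3 × Fin 3, inner ℝ (-M⁻¹ p.1 p.2 + N⁻¹ p.1 p.2) (H p) =
      -(M⁻¹ p.1 p.2 * H p) + N⁻¹ p.1 p.2 * H p := fun p => by
    simp; ring
  simp only [this, Finset.sum_add_distrib, Finset.sum_neg_distrib]
  ring

/-! ### Function spaces on a domain `Ω` of `ℝ ^ d` -/

/-- Physical space. -/
abbrev Space (d : ℕ) : Type := EuclideanSpace ℝ (Fin d)

variable {d : ℕ}

/-- `L²(Ω)` with tensor values; its norm is `‖A‖ ^ 2 = ∫_Ω |A| ^ 2`. -/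
abbrev L2 (Ω : Set (Space d)) : Type := Lp Tensor 2 (volume.restrict Ω)

/-- The direction of the partial derivative `∂_k`, `k = 1, 2, 3` (numbered from `0` here). In
dimension `d < 3` fields do not depend on the missing coordinates: the direction is then `0`, and
the corresponding derivative vanishes. -/
def axis (d : ℕ) (k : Fin 3) : Space d :=
  if h : (k : ℕ) < d then EuclideanSpace.single ⟨k, h⟩ 1 else 0

/-- `D k` is the weak derivative `∂_k u` on `Ω`, for `k = 1, 2, 3`. -/
def HasWeakGrad (Ω : Set (Space d)) (u : L2 Ω) (D : Fin 3 → L2 Ω) : Prop :=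
  ∀ (k : Fin 3) (η : Space d → ℝ), ContDiff ℝ ∞ η → HasCompactSupport η → tsupport η ⊆ Ω →
    ∫ x in Ω, (fderiv ℝ η x (axis d k)) • u x = -∫ x in Ω, η x • (D k) x

/-- `u ∈ H¹(Ω)`. -/
def MemH1 (Ω : Set (Space d)) (u : L2 Ω) : Prop := ∃ D, HasWeakGrad Ω u D

/-- `u ∈ H¹₀(Ω)`: `u` lies in the closure of the smooth compactly supported fields in `H¹(Ω)`. -/
def MemH10 (Ω : Set (Space d)) (u : L2 Ω) : Prop :=
  ∃ D, HasWeakGrad Ω u D ∧ ∃ ψ : ℕ → Space d → Tensor,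
    (∀ m, ContDiff ℝ ∞ (ψ m) ∧ HasCompactSupport (ψ m) ∧ tsupport (ψ m) ⊆ Ω) ∧
    Tendsto (fun m => eLpNorm (fun x => ψ m x - u x) 2 (volume.restrict Ω)) atTop (𝓝 0) ∧
    ∀ k, Tendsto (fun m => eLpNorm (fun x => fderiv ℝ (ψ m) x (axis d k) - (D k) x) 2
      (volume.restrict Ω)) atTop (𝓝 0)

/-! ### The gradient flow and the first-order scheme -/

/-- The weak form of minus the elastic operator
`c₂₁ Δ Q_ij + (c₂₂ / 2) (∂_ik Q_kj + ∂_jk Q_ki - (2/3) ∂_kl Q_kl δ_ij)`: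
at a point, `D k = ∂_k Q` and `F k = ∂_k φ`, where `φ` is the test field. -/
def elasticForm (c21 c22 : ℝ) (D F : Fin 3 → Tensor) : ℝ :=
  c21 * ∑ k, inner ℝ (D k) (F k) +
    c22 / 2 * (∑ i, ∑ j, ∑ k, (D k (k, j) * F i (i, j) + D k (k, i) * F j (i, j))
      - 2 / 3 * ∑ i, ∑ k, ∑ l, D l (k, l) * F k (i, i))

/-- `Q ∈ H¹(Ω)`, with values in the physical tensors a.e., solves weakly
`P(∂q/∂Q)_ij - c₂₁ Δ Q_ij - (c₂₂ / 2) (∂_ik Q_kj + ∂_jk Q_ki - (2/3) ∂_kl Q_kl δ_ij) = f_ij`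
in `Ω`; the test fields are those of `H¹₀(Ω) ∩ L^∞(Ω)`. -/
def SolvesWeakly (Ω : Set (Space d)) (c21 c22 : ℝ) (Q f : L2 Ω) : Prop :=
  (∀ᵐ x ∂(volume.restrict Ω), Q x ∈ physical) ∧
  ∃ D, HasWeakGrad Ω Q D ∧
    ∀ φ : L2 Ω, MemH10 Ω φ → (∃ M : ℝ, ∀ᵐ x ∂(volume.restrict Ω), ‖φ x‖ ≤ M) →
      ∀ F, HasWeakGrad Ω φ F →
        Integrable (fun x => inner ℝ (proj (quasiEntropyGrad (Q x))) (φ x)) (volume.restrict Ω) ∧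
        (∫ x in Ω, inner ℝ (proj (quasiEntropyGrad (Q x))) (φ x)) +
          (∫ x in Ω, elasticForm c21 c22 (fun k => D k x) (fun k => F k x)) =
            ∫ x in Ω, inner ℝ (f x) (φ x)

/-- One step `Q ↦ Q'` of the first-order scheme,
`(Q' - Q) / δt = - P(∂q/∂Q') + c₀₂ Q + c₂₁ Δ Q' + (c₂₂ / 2) (…)(Q')` in `Ω`,
with the boundary values of `G ∈ H¹(Ω)`. -/
def SchemeStep (Ω : Set (Space d)) (G : L2 Ω) (c02 c21 c22 δt : ℝ) (Q Q' : L2 Ω) : Prop :=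
  MemH10 Ω (Q' - G) ∧
  SolvesWeakly Ω c21 c22 Q' (c02 • Q - δt⁻¹ • (Q' - Q))

/-- `v` is the weak (distributional) derivative of `u` on `(0, T)`, with values in `L²(Ω)`. -/
def HasWeakTimeDeriv (Ω : Set (Space d)) (T : ℝ) (u v : ℝ → L2 Ω) : Prop :=
  ∀ η : ℝ → ℝ, ContDiff ℝ ∞ η → HasCompactSupport η → tsupport η ⊆ Set.Ioo 0 T →
    ∫ t in Set.Ioo 0 T, deriv η t • u t = -∫ t in Set.Ioo 0 T, η t • v t

/-- The gradient flow `∂_t Q = - δE/δQ`, that is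
`∂_t Q = - P(∂q/∂Q) + c₀₂ Q + c₂₁ Δ Q + (c₂₂ / 2) (…)(Q)` in `Ω` for a.e. `t ∈ (0, T)`, with the
boundary values of `G`. Here `Qt` is `∂_t Q`. -/
def IsGradientFlow (Ω : Set (Space d)) (G : L2 Ω) (c02 c21 c22 T : ℝ) (Q Qt : ℝ → L2 Ω) : Prop :=
  ∀ᵐ t ∂(volume.restrict (Set.Ioo 0 T)),
    MemH10 Ω (Q t - G) ∧ SolvesWeakly Ω c21 c22 (Q t) (c02 • Q t - Qt t)

end QTensor

end

/-! The spatial operator `𝓐(Q) = P(∂q/∂Q) - 𝓛Q` is monotone on fields with common boundary values,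
and the scheme treats exactly this part implicitly. If two solutions have right-hand sides `f` and
`g`, then `⟪f - g, u - v⟫ ≥ 0` (`SolvesWeakly.inner_sub_nonneg`). Hence neither the singular entropy
nor the elastic term needs a Lipschitz bound; only the explicit term `c₀₂ Q` and the consistency
errors remain.

Monotonicity has two sources. The entropy is convex because inversion of positive definite matrices
reverses order (`inner_proj_quasiEntropyGrad_sub_nonneg`). The elastic form on symmetric traceless
fields is `c₂₁|∇φ|² + c₂₂|div φ|²`; on `H¹₀` the divergence term can be traded for `∂_kφ_ij
∂_iφ_kj`, so `c₂₁ + c₂₂ ≥ 0` suffices even when `c₂₂ < 0` (`MemH10.integral_elasticForm_nonneg`).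
The difference of two physical fields is bounded, hence an admissible test field.

The flow holds only for a.e. time, possibly not at the grid times. Since `∂_tQ` has a continuous
representative `P`, the monotonicity inequality, rather than the equation, passes to every `t ∈ [0,
T]` by continuity. At `t^{n+1}` it is an energy inequality for `R^{n+1}`, with errors `Q(t^n) -
Q(t^{n+1})` and `P(t^{n+1})` minus the difference quotient. Their squares are at most `δt` times the
integrals of `‖∂_tQ‖²` and `‖∂_ttQ‖²` over the step. Young's inequality (`energy_step`) and a
discrete Gronwall argument (`le_exp_mul_add`) finish. -/

noncomputable section

namespace QTensor

/-! ### Convexity of the quasi-entropy and bounds on physical tensors -/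

section Algebra
open scoped MatrixOrder
open Matrix

/-- The product need not be symmetric, but with `M = B* B` cyclicity of the trace replaces it by the
semidefinite `B N B*`. -/
lemma trace_mul_nonneg_of_posSemidef {M N : Matrix (Fin 3) (Fin 3) ℝ} (hM : M.PosSemidef)
    (hN : N.PosSemidef) : 0 ≤ (M * N).trace := by
  obtain ⟨B, rfl⟩ := CStarAlgebra.nonneg_iff_eq_star_mul_self.1 hM.nonneg
  rw [Matrix.mul_assoc, Matrix.trace_mul_comm]
  exact (hN.mul_mul_conjTranspose_same B).trace_nonneg

/-- Inversion of positive definite matrices is decreasing. -/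
lemma trace_inv_sub_inv_mul_sub_nonpos {M N : Matrix (Fin 3) (Fin 3) ℝ} (hM : M.PosDef)
    (hN : N.PosDef) : ((M⁻¹ - N⁻¹) * (M - N)).trace ≤ 0 := by
  have h1 : M⁻¹ * M = 1 := Matrix.nonsing_inv_mul _ hM.det_pos.ne'.isUnit
  have h2 : N * N⁻¹ = 1 := Matrix.mul_nonsing_inv _ hN.det_pos.ne'.isUnit
  -- The resolvent identity makes the trace minus that of `M⁻¹` times `(M - N) N⁻¹ (M - N)`, both
  -- factors being semidefinite.
  have h3 : M⁻¹ - N⁻¹ = -(M⁻¹ * (M - N) * N⁻¹) := by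
    rw [Matrix.mul_sub, Matrix.sub_mul, h1, Matrix.mul_assoc, h2]
    simp
  have hH : (M - N)ᴴ = M - N := by
    rw [Matrix.conjTranspose_sub, hM.isHermitian.eq, hN.isHermitian.eq]
  have h4 : ((M - N) * N⁻¹ * (M - N)).PosSemidef := by
    have := hN.inv.posSemidef.mul_mul_conjTranspose_same (M - N)
    rwa [hH] at this
  have := trace_mul_nonneg_of_posSemidef hM.inv.posSemidef h4
  rw [h3, Matrix.neg_mul, Matrix.trace_neg]
  simp only [Matrix.mul_assoc] at this ⊢
  linarith

lemma posDef_of_forall_spectrum_pos {M : Matrix (Fin 3) (Fin 3) ℝ} (hM : M.IsSymm)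
    (h : ∀ μ ∈ spectrum ℝ M, 0 < μ) : M.PosDef := by
  have hM' : M.IsHermitian := by
    rwa [Matrix.IsHermitian, Matrix.conjTranspose_eq_transpose_of_trivial]
  exact hM'.posDef_iff_eigenvalues_pos.2 fun i => h _ (hM'.eigenvalues_mem_spectrum_real i)

lemma posDef_toMat_add {A : Tensor} (hA : A ∈ physical) :
    (toMat A + (1 / 3 : ℝ) • (1 : Matrix (Fin 3) (Fin 3) ℝ)).PosDef := by
  refine posDef_of_forall_spectrum_pos ?_ fun μ hμ => ?_
  · rw [Matrix.IsSymm, Matrix.transpose_add, hA.1.eq]; simp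
  · have : μ - 1 / 3 ∈ spectrum ℝ (toMat A) := by
      rw [spectrum.mem_iff, Algebra.algebraMap_eq_smul_one] at hμ ⊢
      convert hμ using 2
      module
    have := (hA.2.2 _ this).1
    linarith

lemma posDef_sub_toMat {A : Tensor} (hA : A ∈ physical) :
    ((1 / 3 : ℝ) • (1 : Matrix (Fin 3) (Fin 3) ℝ) - (1 / 2 : ℝ) • toMat A).PosDef := by
  refine posDef_of_forall_spectrum_pos ?_ fun μ hμ => ?_
  · rw [Matrix.IsSymm, Matrix.transpose_sub, Matrix.transpose_smul, Matrix.transpose_smul,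
      hA.1.eq]; simp
  · have : 2 / 3 - 2 * μ ∈ spectrum ℝ (toMat A) := by
      rw [spectrum.mem_iff, Algebra.algebraMap_eq_smul_one] at hμ ⊢
      rw [Matrix.isUnit_iff_isUnit_det, isUnit_iff_ne_zero, not_not] at hμ ⊢
      have e : (2 / 3 - 2 * μ) • (1 : Matrix (Fin 3) (Fin 3) ℝ) - toMat A = (-2 : ℝ) •
          (μ • 1 - ((1 / 3 : ℝ) • (1 : Matrix (Fin 3) (Fin 3) ℝ) - (1 / 2 : ℝ) • toMat A)) := by
        module
      rw [e, Matrix.det_smul, hμ, mul_zero]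
    have := (hA.2.2 _ this).2
    linarith

lemma inner_eq_sum (A B : Tensor) : inner ℝ A B = ∑ i, ∑ j, A (i, j) * B (i, j) := by
  rw [PiLp.inner_apply, Fintype.sum_prod_type]
  simp [mul_comm]

lemma inner_ofMat (M : Matrix (Fin 3) (Fin 3) ℝ) (B : Tensor) (hB : (toMat B).IsSymm) :
    inner ℝ (ofMat M) B = (M * toMat B).trace := by
  rw [inner_eq_sum]
  simp only [Matrix.trace, Matrix.diag, Matrix.mul_apply, toMat, Matrix.of_apply, ofMat]
  refine Finset.sum_congr rfl fun i _ => Finset.sum_congr rfl fun j _ => ?_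
  have := hB.apply i j
  simp only [toMat, Matrix.of_apply] at this
  rw [this]

lemma toMat_sub (A B : Tensor) : toMat (A - B) = toMat A - toMat B := by
  ext i j; simp [toMat]

/-- `proj` as a continuous linear map. -/
def projCLM : Tensor →L[ℝ] Tensor := LinearMap.toContinuousLinearMap
  { toFun := proj
    map_add' := fun A B => by
      ext ⟨i, j⟩
      simp only [proj, PiLp.add_apply, Finset.sum_add_distrib]
      split_ifs <;> ring
    map_smul' := fun c A => by
      ext ⟨i, j⟩
      simp only [proj, PiLp.smul_apply, smul_eq_mul, RingHom.id_apply, ← Finset.mul_sum]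
      split_ifs <;> ring }

@[simp] lemma projCLM_apply (A : Tensor) : projCLM A = proj A := rfl

lemma proj_sub (A B : Tensor) : proj (A - B) = proj A - proj B := projCLM.map_sub A B

lemma inner_proj_left (A B : Tensor) : inner ℝ (proj A) B = inner ℝ A (proj B) := by
  simp only [inner_eq_sum, proj, Fin.sum_univ_three]
  simp
  ring

lemma proj_of_mem_physical {A : Tensor} (hA : A ∈ physical) : proj A = A := by
  ext ⟨i, j⟩
  have h1 := hA.1.apply i j
  have h2 : ∑ k, A (k, k) = 0 := hA.2.1
  simp only [toMat, Matrix.of_apply] at h1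
  simp only [proj, h1, h2]
  simp

lemma apply_swap_of_proj_eq {A : Tensor} (hA : proj A = A) (i j : Fin 3) :
    A (j, i) = A (i, j) := by
  rw [← hA]
  simp only [proj, eq_comm (a := j), add_comm (A (j, i))]

lemma sum_diag_of_proj_eq {A : Tensor} (hA : proj A = A) : ∑ k, A (k, k) = 0 := by
  rw [← hA]
  simp only [proj, Fin.sum_univ_three]
  simp
  ring

/-- The quasi-entropy is convex on the physical tensors: its projected gradient is monotone. -/
theorem inner_proj_quasiEntropyGrad_sub_nonneg {A B : Tensor} (hA : A ∈ physical)
    (hB : B ∈ physical) :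
    0 ≤ inner ℝ (proj (quasiEntropyGrad A) - proj (quasiEntropyGrad B)) (A - B) := by
  have hs : (toMat (A - B)).IsSymm := by
    rw [toMat_sub, Matrix.IsSymm, Matrix.transpose_sub, hA.1.eq, hB.1.eq]
  -- The projection is self-adjoint and fixes `A - B`, so it drops out.
  rw [← proj_sub, inner_proj_left, proj_sub, proj_of_mem_physical hA, proj_of_mem_physical hB,
    quasiEntropyGrad_eq hA, quasiEntropyGrad_eq hB, inner_sub_left, inner_ofMat _ _ hs,
    inner_ofMat _ _ hs, toMat_sub]
  have h1 := trace_inv_sub_inv_mul_sub_nonpos (posDef_toMat_add hA) (posDef_toMat_add hB)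
  have h2 := trace_inv_sub_inv_mul_sub_nonpos (posDef_sub_toMat hA) (posDef_sub_toMat hB)
  rw [add_sub_add_right_eq_sub] at h1
  rw [sub_sub_sub_cancel_left, ← smul_sub, Matrix.mul_smul, Matrix.trace_smul,
    ← neg_sub (toMat A), Matrix.mul_neg, Matrix.trace_neg] at h2
  simp only [Matrix.add_mul, Matrix.neg_mul, Matrix.sub_mul, Matrix.trace_add, Matrix.trace_neg,
    Matrix.trace_sub, smul_eq_mul] at h1 h2 ⊢
  linarith

/-- `A + I/3` is positive with trace one, so its entries have modulus at most one. The constant is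
crude: nine entries of modulus at most 2. Only boundedness matters, for the admissibility of test
fields. -/
lemma norm_le_of_mem_physical {A : Tensor} (hA : A ∈ physical) : ‖A‖ ≤ 6 := by
  have hM := (posDef_toMat_add hA).posSemidef
  set M := toMat A + (1 / 3 : ℝ) • (1 : Matrix (Fin 3) (Fin 3) ℝ) with hMdef
  have htr : M 0 0 + M 1 1 + M 2 2 = 1 := by
    have h2 : ∑ k, A (k, k) = 0 := hA.2.1
    simp only [Fin.sum_univ_three] at h2
    simp [hMdef, toMat]
    linarith
  have hd : ∀ i, 0 ≤ M i i := fun i => hM.diag_nonneg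
  have hsymm : ∀ i j, M i j = M j i := fun i j => by
    have := hM.isHermitian.apply j i
    simpa using this
  -- The quadratic form at `e_i + c e_j`; `c = ±1` gives `2 |M_ij| ≤ M_ii + M_jj ≤ 2`.
  have hq : ∀ (i j : Fin 3) (c : ℝ), 0 ≤ M i i + c * M i j + c * M j i + c ^ 2 * M j j := by
    intro i j c
    have := hM.dotProduct_mulVec_nonneg (Pi.single i 1 + Pi.single j c)
    simp only [star_trivial, Matrix.mulVec_add, dotProduct_add, add_dotProduct,
      Matrix.mulVec_single, single_dotProduct] at this
    simp at this
    nlinarith [this]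
  have hle : ∀ i, M i i ≤ 1 := fun i => by
    have h0 := hd 0; have h1 := hd 1; have h2 := hd 2
    fin_cases i <;> simp <;> linarith
  have hb : ∀ i j, |M i j| ≤ 1 := fun i j => by
    have h1 := hq i j 1
    have h2 := hq i j (-1)
    have := hsymm i j
    have := hle i
    have := hle j
    rw [abs_le]; constructor <;> linarith
  have hA2 : ∀ p : Fin 3 × Fin 3, ‖A p‖ ^ 2 ≤ 4 := fun p => by
    have h1 := hb p.1 p.2
    have h2 : M p.1 p.2 = A p + (if p.1 = p.2 then 1 / 3 else 0) := by
      simp [hMdef, toMat, Matrix.one_apply]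
    rw [Real.norm_eq_abs, sq_abs]
    rw [h2, abs_le] at h1
    split_ifs at h1 <;> nlinarith
  have : ‖A‖ ^ 2 ≤ 36 := by
    rw [EuclideanSpace.norm_sq_eq]
    calc _ ≤ ∑ _p : Fin 3 × Fin 3, (4 : ℝ) := Finset.sum_le_sum fun p _ => hA2 p
      _ = 36 := by simp; norm_num
  nlinarith [norm_nonneg A]

end Algebra

/-! ### Weak gradients and the exchange of derivatives in `H¹₀` -/

section Sobolev

variable {d : ℕ} {Ω : Set (Space d)}

lemma integrable_smul_of_hasCompactSupport (u : L2 Ω) {g : Space d → ℝ} (hg : Continuous g)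
    (hc : HasCompactSupport g) : Integrable (fun x => g x • u x) (volume.restrict Ω) :=
  ((Lp.memLp u).locallyIntegrable one_le_two).integrable_smul_left_of_hasCompactSupport hg hc

lemma integral_smul_sub_apply (u v : L2 Ω) {g : Space d → ℝ} (hg : Continuous g)
    (hc : HasCompactSupport g) :
    ∫ x in Ω, g x • (u - v) x = (∫ x in Ω, g x • u x) - ∫ x in Ω, g x • v x := by
  rw [← integral_sub (integrable_smul_of_hasCompactSupport u hg hc)
    (integrable_smul_of_hasCompactSupport v hg hc)]
  refine integral_congr_ae ?_
  filter_upwards [Lp.coeFn_sub u v] with x hx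
  rw [hx, Pi.sub_apply, smul_sub]

lemma HasWeakGrad.sub {u v : L2 Ω} {D E : Fin 3 → L2 Ω} (hu : HasWeakGrad Ω u D)
    (hv : HasWeakGrad Ω v E) : HasWeakGrad Ω (u - v) (D - E) := by
  intro k η hη hc hs
  have h1 : Continuous fun x => fderiv ℝ η x (axis d k) :=
    (hη.continuous_fderiv (by simp)).clm_apply continuous_const
  rw [integral_smul_sub_apply u v h1 (hc.fderiv_apply ℝ _), Pi.sub_apply,
    integral_smul_sub_apply _ _ hη.continuous hc, hu k η hη hc hs, hv k η hη hc hs]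
  abel

lemma HasWeakGrad.compLp {u : L2 Ω} {D : Fin 3 → L2 Ω} (hu : HasWeakGrad Ω u D)
    (L : Tensor →L[ℝ] Tensor) : HasWeakGrad Ω (L.compLp u) fun k => L.compLp (D k) := by
  have key : ∀ (w : L2 Ω) (g : Space d → ℝ), Continuous g → HasCompactSupport g →
      ∫ x in Ω, g x • (L.compLp w) x = L (∫ x in Ω, g x • w x) := fun w g hg hc => by
    rw [← L.integral_comp_comm (integrable_smul_of_hasCompactSupport w hg hc)]
    refine integral_congr_ae ?_
    filter_upwards [L.coeFn_compLp w] with x hx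
    rw [hx, L.map_smul]
  intro k η hη hc hs
  rw [key _ _ ((hη.continuous_fderiv (by simp)).clm_apply continuous_const)
    (hc.fderiv_apply ℝ _), key _ _ hη.continuous hc, hu k η hη hc hs, map_neg]

/-- Weak gradients are unique. -/
lemma HasWeakGrad.unique (hΩ : IsOpen Ω) {u : L2 Ω} {D E : Fin 3 → L2 Ω}
    (hD : HasWeakGrad Ω u D) (hE : HasWeakGrad Ω u E) : D = E := by
  funext k
  rw [← sub_eq_zero, Lp.eq_zero_iff_ae_eq_zero]
  have h : ∀ᵐ x ∂(volume.restrict Ω), x ∈ Ω → (D k - E k) x = 0 := by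
    refine hΩ.ae_eq_zero_of_integral_contDiff_smul_eq_zero
      (((Lp.memLp (D k - E k)).locallyIntegrable one_le_two).locallyIntegrableOn _)
      fun η hη hc hs => ?_
    rw [integral_smul_sub_apply _ _ hη.continuous hc, sub_eq_zero, ← neg_inj,
      ← hD k η hη hc hs, ← hE k η hη hc hs]
  filter_upwards [h, ae_restrict_mem hΩ.measurableSet] with x hx hxΩ
  exact hx hxΩ

/-- A constant linear map commutes with weak differentiation, so the projected gradient is again a
weak gradient of `u`; uniqueness identifies the two. -/
lemma HasWeakGrad.proj_eq (hΩ : IsOpen Ω) {u : L2 Ω} {D : Fin 3 → L2 Ω}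
    (hD : HasWeakGrad Ω u D) (hu : ∀ᵐ x ∂(volume.restrict Ω), proj (u x) = u x) (k : Fin 3) :
    ∀ᵐ x ∂(volume.restrict Ω), proj (D k x) = D k x := by
  have h1 : projCLM.compLp u = u := by
    refine Lp.ext ?_
    filter_upwards [projCLM.coeFn_compLp u, hu] with x hx hx'
    rw [hx, projCLM_apply, hx']
  have h2 := hD.compLp projCLM
  rw [h1] at h2
  have h3 := congrFun (h2.unique hΩ hD) k
  filter_upwards [projCLM.coeFn_compLp (D k)] with x hx
  rw [← projCLM_apply, ← hx, h3]

lemma MemH10.sub {u v : L2 Ω} (hu : MemH10 Ω u) (hv : MemH10 Ω v) : MemH10 Ω (u - v) := by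
  obtain ⟨D, hD, ψ, hψ, hψu, hψD⟩ := hu
  obtain ⟨E, hE, χ, hχ, hχv, hχE⟩ := hv
  have key : ∀ (a b : ℕ → Space d → Tensor) (f g : L2 Ω), (∀ m, Continuous (a m)) →
      (∀ m, Continuous (b m)) →
      Tendsto (fun m => eLpNorm (fun x => a m x - f x) 2 (volume.restrict Ω)) atTop (𝓝 0) →
      Tendsto (fun m => eLpNorm (fun x => b m x - g x) 2 (volume.restrict Ω)) atTop (𝓝 0) →
      Tendsto (fun m => eLpNorm (fun x => (a m x - b m x) - (f - g) x) 2 (volume.restrict Ω))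
        atTop (𝓝 0) := by
    intro a b f g ha hb hf hg
    have h0 := hf.add hg
    rw [add_zero] at h0
    refine tendsto_of_tendsto_of_tendsto_of_le_of_le tendsto_const_nhds h0 (fun _ => zero_le)
      fun m => ?_
    have e : (fun x => (a m x - b m x) - (f - g) x) =ᵐ[volume.restrict Ω]
        (fun x => a m x - f x) - fun x => b m x - g x := by
      filter_upwards [Lp.coeFn_sub f g] with x hx
      rw [hx, Pi.sub_apply, Pi.sub_apply]
      abel
    rw [eLpNorm_congr_ae e]
    exact eLpNorm_sub_le ((ha m).aestronglyMeasurable.sub (Lp.aestronglyMeasurable f))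
      ((hb m).aestronglyMeasurable.sub (Lp.aestronglyMeasurable g)) one_le_two
  refine ⟨D - E, hD.sub hE, fun m => ψ m - χ m, fun m => ⟨(hψ m).1.sub (hχ m).1,
    (hψ m).2.1.sub (hχ m).2.1, (tsupport_sub _ _).trans
      (Set.union_subset (hψ m).2.2 (hχ m).2.2)⟩, ?_, fun k => ?_⟩
  · exact key ψ χ u v (fun m => (hψ m).1.continuous) (fun m => (hχ m).1.continuous) hψu hχv
  · have := key (fun m x => fderiv ℝ (ψ m) x (axis d k)) (fun m x => fderiv ℝ (χ m) x (axis d k))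
      (D k) (E k)
      (fun m => ((hψ m).1.continuous_fderiv (by simp)).clm_apply continuous_const)
      (fun m => ((hχ m).1.continuous_fderiv (by simp)).clm_apply continuous_const) (hψD k) (hχE k)
    convert this using 4 with m x
    rw [fderiv_sub (((hψ m).1.differentiable (by simp)) x) (((hχ m).1.differentiable (by simp)) x)]
    rfl

/-- For smooth `f` and `g`, `g` compactly supported, `∫ ∂_a f ∂_b g = ∫ ∂_b f ∂_a g`. -/
lemma integral_fderiv_mul_fderiv_swap {f g : Space d → ℝ} (hf : ContDiff ℝ ∞ f)
    (hg : ContDiff ℝ ∞ g) (hgc : HasCompactSupport g)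
    (a b : Space d) :
    ∫ x, fderiv ℝ f x a * fderiv ℝ g x b = ∫ x, fderiv ℝ f x b * fderiv ℝ g x a := by
  have hf' : ∀ v, ContDiff ℝ ∞ fun x => fderiv ℝ f x v := fun v =>
    (hf.fderiv_right (by simp)).clm_apply contDiff_const
  have hg' : ∀ v, Continuous fun x => fderiv ℝ g x v := fun v =>
    (hg.continuous_fderiv (by simp)).clm_apply continuous_const
  have hf'' : ∀ v w, Continuous fun x => fderiv ℝ (fun y => fderiv ℝ f y v) x w := fun v w =>
    ((hf' v).continuous_fderiv (by simp)).clm_apply continuous_const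
  -- Both derivatives are moved onto `f`, where symmetry of the second derivative exchanges the
  -- directions.
  have key : ∀ v w, ∫ x, fderiv ℝ f x v * fderiv ℝ g x w =
      -∫ x, fderiv ℝ (fun y => fderiv ℝ f y v) x w * g x := fun v w => by
    refine integral_mul_fderiv_eq_neg_fderiv_mul_of_integrable ?_ ?_ ?_
      (fun x _ => ((hf' v).differentiable (by simp)) x)
      (fun x _ => (hg.differentiable (by simp)) x)
    · exact ((hf'' v w).mul hg.continuous).integrable_of_hasCompactSupport hgc.mul_left
    · exact ((hf' v).continuous.mul (hg' w)).integrable_of_hasCompactSupport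
        (hgc.fderiv_apply ℝ w).mul_left
    · exact ((hf' v).continuous.mul hg.continuous).integrable_of_hasCompactSupport hgc.mul_left
  have hsymm : ∀ x, fderiv ℝ (fun y => fderiv ℝ f y a) x b =
      fderiv ℝ (fun y => fderiv ℝ f y b) x a := fun x => by
    have hd : DifferentiableAt ℝ (fderiv ℝ f) x :=
      ((hf.fderiv_right (m := ∞) (by simp)).differentiable (by simp)) x
    have hs : IsSymmSndFDerivAt ℝ f x := hf.contDiffAt.isSymmSndFDerivAt
      (by rw [minSmoothness_of_isRCLikeNormedField]; exact ENat.LEInfty.out)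
    rw [fderiv_clm_apply hd (differentiableAt_const _),
      fderiv_clm_apply hd (differentiableAt_const _)]
    simpa using hs b a
  rw [key, key]
  simp only [hsymm]

/-- The `p`-component of an `L²` tensor field. -/
def comp (p : Fin 3 × Fin 3) : L2 Ω →L[ℝ] Lp ℝ 2 (volume.restrict Ω) :=
  (EuclideanSpace.proj p : Tensor →L[ℝ] ℝ).compLpL 2 (volume.restrict Ω)

lemma comp_apply_ae (p : Fin 3 × Fin 3) (u : L2 Ω) :
    ∀ᵐ x ∂(volume.restrict Ω), comp p u x = u x p :=
  (EuclideanSpace.proj p : Tensor →L[ℝ] ℝ).coeFn_compLp u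

lemma integrable_apply_mul_apply (u v : L2 Ω) (p q : Fin 3 × Fin 3) :
    Integrable (fun x => u x p * v x q) (volume.restrict Ω) := by
  refine (L2.integrable_inner (𝕜 := ℝ) (comp p u) (comp q v)).congr ?_
  filter_upwards [comp_apply_ae p u, comp_apply_ae q v] with x h1 h2
  rw [h1, h2, real_inner_eq_re_inner]
  simp [mul_comm]

lemma inner_comp_comp (u v : L2 Ω) (p q : Fin 3 × Fin 3) :
    inner ℝ (comp p u) (comp q v) = ∫ x in Ω, u x p * v x q := by
  rw [L2.inner_def]
  refine integral_congr_ae ?_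
  filter_upwards [comp_apply_ae p u, comp_apply_ae q v] with x h1 h2
  rw [h1, h2]
  simp [mul_comm]

lemma fderiv_apply_comp {ψ : Space d → Tensor} (hψ : ContDiff ℝ ∞ ψ) (x v : Space d)
    (p : Fin 3 × Fin 3) : fderiv ℝ ψ x v p = fderiv ℝ (fun y => ψ y p) x v := by
  have h := (EuclideanSpace.proj p : Tensor →L[ℝ] ℝ).hasFDerivAt.comp x
    ((hψ.differentiable (by simp)) x).hasFDerivAt
  have h2 : fderiv ℝ (fun y => ψ y p) x = _ := h.fderiv
  rw [h2]
  rfl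

/-- Interchange of partial derivatives in `H¹₀(Ω)`:
`∫ ∂_i φ_p ∂_k φ_q = ∫ ∂_k φ_p ∂_i φ_q`. -/
lemma MemH10.integral_grad_swap (hΩ : IsOpen Ω) {φ : L2 Ω} (hφ : MemH10 Ω φ)
    {F : Fin 3 → L2 Ω} (hF : HasWeakGrad Ω φ F) (i k : Fin 3) (p q : Fin 3 × Fin 3) :
    ∫ x in Ω, F i x p * F k x q = ∫ x in Ω, F k x p * F i x q := by
  obtain ⟨D, hD, ψ, hψ, -, hψD⟩ := hφ
  obtain rfl := hD.unique hΩ hF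
  have hc : ∀ m k, Continuous fun x => fderiv ℝ (ψ m) x (axis d k) := fun m k =>
    ((hψ m).1.continuous_fderiv (by simp)).clm_apply continuous_const
  have hmem : ∀ m k, MemLp (fun x => fderiv ℝ (ψ m) x (axis d k)) 2 (volume.restrict Ω) :=
    fun m k => (hc m k).memLp_of_hasCompactSupport ((hψ m).2.1.fderiv_apply ℝ _)
  have hlim : ∀ k, Tendsto (fun m => (hmem m k).toLp) atTop (𝓝 (D k)) := fun k => by
    rw [Lp.tendsto_Lp_iff_tendsto_eLpNorm']
    refine (hψD k).congr fun m => eLpNorm_congr_ae ?_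
    filter_upwards [(hmem m k).coeFn_toLp] with x hx
    rw [Pi.sub_apply, hx]
  have hconv : ∀ i k, Tendsto (fun m => inner ℝ (comp p ((hmem m i).toLp))
      (comp q ((hmem m k).toLp))) atTop (𝓝 (inner ℝ (comp p (D i)) (comp q (D k)))) :=
    fun i k => (((comp p).continuous.tendsto _).comp (hlim i)).inner
      (((comp q).continuous.tendsto _).comp (hlim k))
  rw [← inner_comp_comp, ← inner_comp_comp]
  refine tendsto_nhds_unique (hconv i k) ((hconv k i).congr fun m => ?_)
  have hsm : ∀ r, ContDiff ℝ ∞ fun y => ψ m y r := fun r =>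
    (EuclideanSpace.proj r : Tensor →L[ℝ] ℝ).contDiff.comp (hψ m).1
  have hsc : ∀ r, HasCompactSupport fun y => ψ m y r := fun r =>
    (hψ m).2.1.comp_left (g := fun A : Tensor => A r) rfl
  -- The approximants are supported in `Ω`, so their integrals extend to the whole space and no
  -- regularity of the boundary is needed.
  have key : ∀ i k, inner ℝ (comp p ((hmem m i).toLp)) (comp q ((hmem m k).toLp)) =
      ∫ x, fderiv ℝ (fun y => ψ m y p) x (axis d i) *
        fderiv ℝ (fun y => ψ m y q) x (axis d k) := fun i k => by
    rw [inner_comp_comp, ← setIntegral_eq_integral_of_forall_compl_eq_zero (s := Ω)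
      (f := fun x => fderiv ℝ (fun y => ψ m y p) x (axis d i) *
        fderiv ℝ (fun y => ψ m y q) x (axis d k))]
    · refine integral_congr_ae ?_
      filter_upwards [(hmem m i).coeFn_toLp, (hmem m k).coeFn_toLp] with x h1 h2
      rw [h1, h2, fderiv_apply_comp (hψ m).1, fderiv_apply_comp (hψ m).1]
    · intro x hx
      have : fderiv ℝ (ψ m) x = 0 := by
        by_contra h
        exact hx ((hψ m).2.2 (support_fderiv_subset (𝕜 := ℝ) (f := ψ m) h))
      rw [← fderiv_apply_comp (hψ m).1, this]
      simp
  rw [key, key]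
  exact integral_fderiv_mul_fderiv_swap (hsm p) (hsm q) (hsc q) _ _

end Sobolev

/-! ### Monotonicity of the spatial operator -/

section Monotonicity

lemma elasticForm_sub_left (c21 c22 : ℝ) (D E F : Fin 3 → Tensor) :
    elasticForm c21 c22 (fun k => D k - E k) F =
      elasticForm c21 c22 D F - elasticForm c21 c22 E F := by
  simp only [elasticForm, inner_sub_left, PiLp.sub_apply, sub_mul, Finset.sum_add_distrib,
    Finset.sum_sub_distrib]
  ring

/-- On gradients of symmetric traceless fields the elastic form is
`c₂₁ |∇Q| ^ 2 + c₂₂ |div Q| ^ 2`. -/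
lemma elasticForm_self (c21 c22 : ℝ) {F : Fin 3 → Tensor} (hF : ∀ k, proj (F k) = F k) :
    elasticForm c21 c22 F F = c21 * ∑ j, ∑ i, ∑ k, F k (i, j) ^ 2 +
      c22 * ∑ j, ∑ i, ∑ k, F i (i, j) * F k (k, j) := by
  have h1 : ∑ k, inner ℝ (F k) (F k) = ∑ j, ∑ i, ∑ k, F k (i, j) ^ 2 := by
    simp only [inner_eq_sum, Fin.sum_univ_three]
    ring
  have h2 : ∑ i, ∑ j, ∑ k, F k (k, j) * F i (i, j) =
      ∑ j, ∑ i, ∑ k, F i (i, j) * F k (k, j) := by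
    rw [Finset.sum_comm]
    simp only [mul_comm]
  have h3 : ∑ i, ∑ j, ∑ k, F k (k, i) * F j (i, j) =
      ∑ j, ∑ i, ∑ k, F i (i, j) * F k (k, j) := by
    refine Finset.sum_congr rfl fun i _ => Finset.sum_congr rfl fun j _ =>
      Finset.sum_congr rfl fun k _ => ?_
    rw [apply_swap_of_proj_eq (hF j), mul_comm]
  -- The `δ_ij` term only sees the trace of the test gradient.
  have h4 : ∑ i, ∑ k, ∑ l, F l (k, l) * F k (i, i) = 0 := by
    rw [Finset.sum_comm]
    refine Finset.sum_eq_zero fun k _ => ?_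
    rw [Finset.sum_comm]
    refine Finset.sum_eq_zero fun l _ => ?_
    rw [← Finset.mul_sum, sum_diag_of_proj_eq (hF k), mul_zero]
  simp only [elasticForm, Finset.sum_add_distrib]
  rw [h1, h2, h3, h4]
  ring

variable {d : ℕ} {Ω : Set (Space d)}

lemma integrable_elasticForm (c21 c22 : ℝ) (D F : Fin 3 → L2 Ω) :
    Integrable (fun x => elasticForm c21 c22 (fun k => D k x) (fun k => F k x))
      (volume.restrict Ω) := by
  unfold elasticForm
  refine ((integrable_finsetSum _ fun k _ => L2.integrable_inner (𝕜 := ℝ) (D k) (F k)).const_mul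
    _).add ((Integrable.sub ?_ ?_).const_mul _)
  · refine integrable_finsetSum _ fun i _ => integrable_finsetSum _ fun j _ =>
      integrable_finsetSum _ fun k _ => ?_
    exact (integrable_apply_mul_apply _ _ _ _).add (integrable_apply_mul_apply _ _ _ _)
  · refine Integrable.const_mul ?_ _
    refine integrable_finsetSum _ fun i _ => integrable_finsetSum _ fun j _ =>
      integrable_finsetSum _ fun k _ => ?_
    exact integrable_apply_mul_apply _ _ _ _

/-- Coercivity of the elastic energy on symmetric traceless fields in `H¹₀(Ω)`. -/
lemma MemH10.integral_elasticForm_nonneg (hΩ : IsOpen Ω) {c21 c22 : ℝ} (h21 : 0 ≤ c21)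
    (h22 : 0 ≤ c21 + c22) {φ : L2 Ω} (hφ : MemH10 Ω φ)
    (hp : ∀ᵐ x ∂(volume.restrict Ω), proj (φ x) = φ x)
    {F : Fin 3 → L2 Ω} (hF : HasWeakGrad Ω φ F) :
    0 ≤ ∫ x in Ω, elasticForm c21 c22 (fun k => F k x) (fun k => F k x) := by
  have hFp : ∀ᵐ x ∂(volume.restrict Ω), ∀ k, proj (F k x) = F k x :=
    ae_all_iff.2 fun k => hF.proj_eq hΩ hp k
  have hnn : ∀ A : Fin 3 → Tensor, 0 ≤ ∑ j, ∑ i, ∑ k, A i (i, j) * A k (k, j) := fun A => by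
    refine Finset.sum_nonneg fun j _ => ?_
    rw [← Finset.sum_mul_sum]
    exact mul_self_nonneg _
  have hle : ∀ A : Fin 3 → Tensor, ∑ j, ∑ i, ∑ k, A k (i, j) * A i (k, j) ≤
      ∑ j, ∑ i, ∑ k, A k (i, j) ^ 2 := fun A => by
    refine Finset.sum_le_sum fun j _ => ?_
    have h : ∑ i, ∑ k, A k (i, j) ^ 2 =
        ∑ i, ∑ k, (A k (i, j) ^ 2 + A i (k, j) ^ 2) / 2 := by
      simp only [Fin.sum_univ_three]
      ring
    rw [h]
    refine Finset.sum_le_sum fun i _ => Finset.sum_le_sum fun k _ => ?_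
    nlinarith [sq_nonneg (A k (i, j) - A i (k, j))]
  have hsq : ∀ A : Fin 3 → Tensor, 0 ≤ ∑ j, ∑ i, ∑ k, A k (i, j) ^ 2 := fun A => by positivity
  have hI : ∀ j i k, Integrable (fun x => F i x (i, j) * F k x (k, j) - F k x (i, j) * F i x (k, j))
      (volume.restrict Ω) := fun j i k =>
    (integrable_apply_mul_apply _ _ _ _).sub (integrable_apply_mul_apply _ _ _ _)
  have hI' : Integrable (fun x => c22 * ∑ j, ∑ i, ∑ k,
      (F i x (i, j) * F k x (k, j) - F k x (i, j) * F i x (k, j))) (volume.restrict Ω) :=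
    (integrable_finsetSum _ fun j _ => integrable_finsetSum _ fun i _ =>
      integrable_finsetSum _ fun k _ => hI j i k).const_mul _
  have hzero : ∫ x in Ω, c22 * ∑ j, ∑ i, ∑ k,
      (F i x (i, j) * F k x (k, j) - F k x (i, j) * F i x (k, j)) = 0 := by
    rw [integral_const_mul, integral_finsetSum _ fun j _ => integrable_finsetSum _ fun i _ =>
      integrable_finsetSum _ fun k _ => hI j i k]
    refine mul_eq_zero_of_right _ (Finset.sum_eq_zero fun j _ => ?_)
    rw [integral_finsetSum _ fun i _ => integrable_finsetSum _ fun k _ => hI j i k]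
    refine Finset.sum_eq_zero fun i _ => ?_
    rw [integral_finsetSum _ fun k _ => hI j i k]
    refine Finset.sum_eq_zero fun k _ => ?_
    rw [integral_sub (integrable_apply_mul_apply _ _ _ _) (integrable_apply_mul_apply _ _ _ _),
      hφ.integral_grad_swap hΩ hF, sub_self]
  -- For `c22 ≥ 0` the integrand is nonnegative pointwise. For `c22 < 0` it is compared with `c22`
  -- times the null Lagrangian of `hzero`: after subtraction, `hle` leaves at least `(c21 + c22)
  -- |∇φ|²`.
  rcases le_or_gt 0 c22 with hc | hc
  · refine integral_nonneg_of_ae ?_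
    filter_upwards [hFp] with x hx
    rw [elasticForm_self _ _ hx]
    exact add_nonneg (mul_nonneg h21 (hsq fun k => F k x)) (mul_nonneg hc (hnn fun k => F k x))
  · rw [← hzero]
    refine integral_mono_ae hI' (integrable_elasticForm _ _ _ _) ?_
    filter_upwards [hFp] with x hx
    rw [elasticForm_self _ _ hx]
    simp only [Finset.sum_sub_distrib]
    have h1 := hle fun k => F k x
    have h2 := mul_nonneg h22 (hsq fun k => F k x)
    have h3 := mul_le_mul_of_nonpos_left h1 hc.le
    simp only at h2 h3
    linarith

/-- The operator of the gradient flow is monotone: two weak solutions with the same boundary values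
satisfy `⟪f - g, u - v⟫ ≥ 0`. -/
theorem SolvesWeakly.inner_sub_nonneg (hΩ : IsOpen Ω) {c21 c22 : ℝ} (h21 : 0 ≤ c21)
    (h22 : 0 ≤ c21 + c22) {G u v f g : L2 Ω} (hu : SolvesWeakly Ω c21 c22 u f)
    (hv : SolvesWeakly Ω c21 c22 v g) (huG : MemH10 Ω (u - G)) (hvG : MemH10 Ω (v - G)) :
    0 ≤ inner ℝ (f - g) (u - v) := by
  obtain ⟨hup, D, hD, hDeq⟩ := hu
  obtain ⟨hvp, E, hE, hEeq⟩ := hv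
  have hφ : MemH10 Ω (u - v) := by
    have := huG.sub hvG
    rwa [sub_sub_sub_cancel_right] at this
  have hsub := Lp.coeFn_sub u v
  have hb : ∃ M : ℝ, ∀ᵐ x ∂(volume.restrict Ω), ‖(u - v) x‖ ≤ M := by
    refine ⟨6 + 6, ?_⟩
    filter_upwards [hup, hvp, hsub] with x h1 h2 h3
    rw [h3, Pi.sub_apply]
    exact (norm_sub_le _ _).trans
      (add_le_add (norm_le_of_mem_physical h1) (norm_le_of_mem_physical h2))
  have hF : HasWeakGrad Ω (u - v) (D - E) := hD.sub hE
  have hp : ∀ᵐ x ∂(volume.restrict Ω), proj ((u - v) x) = (u - v) x := by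
    filter_upwards [hup, hvp, hsub] with x h1 h2 h3
    rw [h3, Pi.sub_apply, proj_sub, proj_of_mem_physical h1, proj_of_mem_physical h2]
  obtain ⟨hi1, he1⟩ := hDeq _ hφ hb _ hF
  obtain ⟨hi2, he2⟩ := hEeq _ hφ hb _ hF
  have hel := hφ.integral_elasticForm_nonneg hΩ h21 h22 hp hF
  have hel' : ∫ x in Ω, elasticForm c21 c22 (fun k => (D - E) k x) (fun k => (D - E) k x) =
      (∫ x in Ω, elasticForm c21 c22 (fun k => D k x) (fun k => (D - E) k x)) -
        ∫ x in Ω, elasticForm c21 c22 (fun k => E k x) (fun k => (D - E) k x) := by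
    rw [← integral_sub (integrable_elasticForm _ _ _ _) (integrable_elasticForm _ _ _ _)]
    refine integral_congr_ae ?_
    have : ∀ᵐ x ∂(volume.restrict Ω), ∀ k, (D - E) k x = D k x - E k x :=
      ae_all_iff.2 fun k => Lp.coeFn_sub (D k) (E k)
    filter_upwards [this] with x hx
    rw [← elasticForm_sub_left]
    simp only [hx]
  have hmono : 0 ≤ (∫ x in Ω, inner ℝ (proj (quasiEntropyGrad (u x))) ((u - v) x)) -
      ∫ x in Ω, inner ℝ (proj (quasiEntropyGrad (v x))) ((u - v) x) := by
    rw [← integral_sub hi1 hi2]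
    refine integral_nonneg_of_ae ?_
    filter_upwards [hup, hvp, hsub] with x h1 h2 h3
    rw [← inner_sub_left, h3]
    exact inner_proj_quasiEntropyGrad_sub_nonneg h1 h2
  rw [inner_sub_left, L2.inner_def, L2.inner_def, ← he1, ← he2]
  linarith

end Monotonicity

/-! ### Weak time derivatives of vector-valued functions -/

section WeakTimeDerivative

variable {E : Type*} [NormedAddCommGroup E] [NormedSpace ℝ E] [CompleteSpace E]

/-- A compactly supported smooth function on `(0, T)` with vanishing integral is the derivative of
another one. -/
lemma exists_deriv_eq_of_integral_eq_zero {T : ℝ} {ζ : ℝ → ℝ} (hζ : ContDiff ℝ ∞ ζ)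
    (hc : HasCompactSupport ζ) (hs : tsupport ζ ⊆ Set.Ioo 0 T) (h0 : ∫ t, ζ t = 0) :
    ∃ η : ℝ → ℝ, ContDiff ℝ ∞ η ∧ HasCompactSupport η ∧ tsupport η ⊆ Set.Ioo 0 T ∧
      deriv η = ζ := by
  rcases (tsupport ζ).eq_empty_or_nonempty with he | hne
  · have hz : ζ = 0 := tsupport_eq_empty_iff.1 he
    exact ⟨0, contDiff_const, HasCompactSupport.zero, by simp [tsupport, Function.support_zero],
      by rw [hz]; exact deriv_const' 0⟩
  obtain ⟨a, ha, hamin⟩ := hc.isCompact.exists_isLeast hne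
  obtain ⟨b, hb, hbmax⟩ := hc.isCompact.exists_isGreatest hne
  have hzero : ∀ s, s ∉ Set.Icc a b → ζ s = 0 := fun s h => by
    by_contra hne'
    have : s ∈ tsupport ζ := subset_tsupport ζ hne'
    exact h ⟨hamin this, hbmax this⟩
  have hint : ∀ x y, IntervalIntegrable ζ volume x y := fun x y =>
    hζ.continuous.intervalIntegrable x y
  have hderiv : ∀ t, HasDerivAt (fun t => ∫ s in (0 : ℝ)..t, ζ s) (ζ t) t := fun t =>
    intervalIntegral.integral_hasDerivAt_right (hint 0 t)
      (hζ.continuous.stronglyMeasurableAtFilter _ _) hζ.continuous.continuousAt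
  have hderiv' : deriv (fun t => ∫ s in (0 : ℝ)..t, ζ s) = ζ := funext fun t => (hderiv t).deriv
  have hsub : tsupport (fun t => ∫ s in (0 : ℝ)..t, ζ s) ⊆ Set.Icc a b := by
    refine closure_minimal (fun t ht => ?_) isClosed_Icc
    by_contra hn
    apply ht
    rw [Set.mem_Icc, not_and_or, not_le, not_le] at hn
    rcases hn with hn | hn
    · refine intervalIntegral.integral_zero_ae (Eventually.of_forall fun s hs' => ?_)
      refine hzero s fun h => ?_
      have := (Set.uIoc_subset_uIcc hs').2
      have := this.trans_lt (max_lt (hs ha).1 hn)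
      exact absurd h.1 this.not_ge
    -- To the right of the support the primitive is the total integral, which vanishes by `h0`.
    · change ∫ s in (0 : ℝ)..t, ζ s = 0
      rw [← intervalIntegral.integral_add_adjacent_intervals (hint 0 T) (hint T t),
        intervalIntegral.integral_eq_integral_of_support_subset
          ((subset_tsupport ζ).trans (hs.trans Set.Ioo_subset_Ioc_self)), h0, zero_add]
      refine intervalIntegral.integral_zero_ae (Eventually.of_forall fun s hs' => ?_)
      refine hzero s fun h => ?_
      have := (Set.uIoc_subset_uIcc hs').1
      have := (lt_min (hs hb).2 hn).trans_le this
      exact absurd h.2 this.not_ge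
  refine ⟨_, ?_, HasCompactSupport.of_support_subset_isCompact isCompact_Icc
    ((subset_tsupport _).trans hsub), hsub.trans (Set.Icc_subset_Ioo (hs ha).1 (hs hb).2), hderiv'⟩
  rw [contDiff_infty_iff_deriv]
  exact ⟨fun t => (hderiv t).differentiableAt, by rwa [hderiv']⟩

/-- **Du Bois-Reymond lemma**: a function with vanishing weak derivative is constant. -/
lemma exists_ae_eq_const_of_integral_deriv_smul_eq_zero {T : ℝ} (hT : 0 < T) {w : ℝ → E}
    (hw : IntegrableOn w (Set.Ioo 0 T))
    (h : ∀ η : ℝ → ℝ, ContDiff ℝ ∞ η → HasCompactSupport η → tsupport η ⊆ Set.Ioo 0 T →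
      ∫ t in Set.Ioo 0 T, deriv η t • w t = 0) :
    ∃ c, ∀ᵐ t ∂(volume.restrict (Set.Ioo 0 T)), w t = c := by
  let B : ContDiffBump (T / 2) := ⟨T / 8, T / 4, by positivity, by linarith⟩
  set β : ℝ → ℝ := B.normed volume with hβ
  have hβd : ContDiff ℝ ∞ β := B.contDiff_normed
  have hβc : HasCompactSupport β := B.hasCompactSupport_normed
  have hβs : tsupport β ⊆ Set.Ioo 0 T := by
    rw [hβ, B.tsupport_normed_eq, Real.closedBall_eq_Icc]
    refine Set.Icc_subset_Ioo ?_ ?_ <;> simp only [B] <;> linarith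
  have hβ1 : ∫ t, β t = 1 := B.integral_normed
  have hi : ∀ (φ : ℝ → ℝ), Continuous φ → HasCompactSupport φ →
      Integrable (fun t => φ t • w t) (volume.restrict (Set.Ioo 0 T)) := fun φ hφ hc =>
    (Integrable.locallyIntegrable hw).integrable_smul_left_of_hasCompactSupport hφ hc
  refine ⟨∫ t in Set.Ioo 0 T, β t • w t, ?_⟩
  set c := ∫ t in Set.Ioo 0 T, β t • w t with hcdef
  have hwc : IntegrableOn (fun t => w t - c) (Set.Ioo 0 T) :=
    hw.sub (integrable_const c)
  have key : ∀ᵐ t, t ∈ Set.Ioo 0 T → w t - c = 0 := by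
    refine isOpen_Ioo.ae_eq_zero_of_integral_contDiff_smul_eq_zero hwc.locallyIntegrableOn
      fun φ hφ hc hs => ?_
    set m := ∫ t, φ t with hm
    have hφi : Integrable φ := hφ.continuous.integrable_of_hasCompactSupport hc
    have hβi : Integrable β := hβd.continuous.integrable_of_hasCompactSupport hβc
    have hmβc : HasCompactSupport fun t => m * β t := hβc.mul_left
    -- Subtracting `(∫ φ) β` makes the mean zero, so the result is the derivative of a test function
    -- and `h` applies.
    obtain ⟨η, hη, hηc, hηs, hd⟩ := exists_deriv_eq_of_integral_eq_zero (T := T)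
      (ζ := fun t => φ t - m * β t) (hφ.sub (contDiff_const.mul hβd)) (hc.sub hmβc)
      ((tsupport_sub φ fun t => m * β t).trans (Set.union_subset hs
        ((closure_mono (Function.support_mul_subset_right _ _)).trans hβs)))
      (by rw [integral_sub hφi (hβi.const_mul m), integral_const_mul, hβ1, mul_one, sub_self])
    have h1 := h η hη hηc hηs
    rw [hd] at h1
    have h2 : ∫ t in Set.Ioo 0 T, (φ t - m * β t) • w t =
        (∫ t in Set.Ioo 0 T, φ t • w t) - m • c := by
      have hm' : Integrable (fun t => m • β t • w t) (volume.restrict (Set.Ioo 0 T)) :=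
        (hi β hβd.continuous hβc).smul m
      rw [hcdef, ← integral_smul, ← integral_sub (hi φ hφ.continuous hc) hm']
      simp only [sub_smul, mul_smul]
    have h3 : ∫ t in Set.Ioo 0 T, φ t • (w t - c) =
        (∫ t in Set.Ioo 0 T, φ t • w t) - m • c := by
      have : ∫ t in Set.Ioo 0 T, φ t • c = m • c := by
        rw [integral_smul_const, setIntegral_eq_integral_of_forall_compl_eq_zero]
        intro x hx
        exact image_eq_zero_of_notMem_tsupport fun h => hx (hs h)
      rw [← this, ← integral_sub (hi φ hφ.continuous hc) (hφi.integrableOn.smul_const c)]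
      simp only [smul_sub]
    rw [← setIntegral_eq_integral_of_forall_compl_eq_zero (s := Set.Ioo 0 T), h3, ← h2, h1]
    intro x hx
    rw [image_eq_zero_of_notMem_tsupport fun h => hx (hs h), zero_smul]
  rw [ae_restrict_iff' measurableSet_Ioo]
  filter_upwards [key] with t ht htm
  exact sub_eq_zero.1 (ht htm)

/-- Integration by parts of a test function against an indefinite integral. -/
lemma integral_deriv_smul_integral_eq_neg {T : ℝ} {v : ℝ → E}
    (hv : IntegrableOn v (Set.Ioo 0 T)) {η : ℝ → ℝ} (hη : ContDiff ℝ ∞ η)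
    (hs : tsupport η ⊆ Set.Ioo 0 T) :
    ∫ t in Set.Ioo 0 T, deriv η t • ∫ s in (0 : ℝ)..t, v s =
      -∫ t in Set.Ioo 0 T, η t • v t := by
  set μ := volume.restrict (Set.Ioo 0 T) with hμ
  have hη'c : Continuous (deriv η) := hη.continuous_deriv (by simp)
  have hη' : Integrable (deriv η) μ :=
    (hη'c.integrableOn_Icc (a := 0) (b := T)).mono_set Set.Ioo_subset_Icc_self
  have hmeas : MeasurableSet {p : ℝ × ℝ | p.2 < p.1} :=
    measurableSet_lt measurable_snd measurable_fst
  -- Fubini on the triangle `0 < s < t < T`: the inner integral of `deriv η` over `(s, T)` is `-η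
  -- s`, because `η T = 0`.
  have hint : Integrable (Set.indicator {p : ℝ × ℝ | p.2 < p.1} fun p => deriv η p.1 • v p.2)
      (μ.prod μ) := (hη'.smul_prod hv).indicator hmeas
  have hηT : η T = 0 := image_eq_zero_of_notMem_tsupport fun h => lt_irrefl _ (hs h).2
  have e1 : ∀ t ∈ Set.Ioo 0 T, deriv η t • ∫ s in (0 : ℝ)..t, v s =
      ∫ s, Set.indicator {p : ℝ × ℝ | p.2 < p.1} (fun p => deriv η p.1 • v p.2) (t, s) ∂μ := by
    intro t ht
    have : ∀ s, Set.indicator {p : ℝ × ℝ | p.2 < p.1} (fun p => deriv η p.1 • v p.2) (t, s) =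
        Set.indicator (Set.Iio t) (fun s => deriv η t • v s) s := fun s => by
      simp [Set.indicator_apply]
    simp only [this]
    rw [integral_indicator measurableSet_Iio, hμ, Measure.restrict_restrict measurableSet_Iio,
      integral_smul, intervalIntegral.integral_of_le ht.1.le, integral_Ioc_eq_integral_Ioo]
    congr 3
    ext s
    simp only [Set.mem_Ioo, Set.mem_inter_iff, Set.mem_Iio]
    constructor
    · exact fun h => ⟨h.2, h.1, h.2.trans ht.2⟩
    · exact fun h => ⟨h.2.1, h.1⟩
  have e2 : ∀ s ∈ Set.Ioo 0 T,
      ∫ t, Set.indicator {p : ℝ × ℝ | p.2 < p.1} (fun p => deriv η p.1 • v p.2) (t, s) ∂μ =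
        -(η s • v s) := by
    intro s hs'
    have : ∀ t, Set.indicator {p : ℝ × ℝ | p.2 < p.1} (fun p => deriv η p.1 • v p.2) (t, s) =
        Set.indicator (Set.Ioi s) (fun t => deriv η t • v s) t := fun t => by
      simp [Set.indicator_apply]
    simp only [this]
    have hset : Set.Ioi s ∩ Set.Ioo 0 T = Set.Ioo s T := by
      ext t
      simp only [Set.mem_Ioo, Set.mem_inter_iff, Set.mem_Ioi]
      constructor
      · exact fun h => ⟨h.1, h.2.2⟩
      · exact fun h => ⟨h.1, hs'.1.trans h.1, h.2⟩
    rw [integral_indicator measurableSet_Ioi, hμ, Measure.restrict_restrict measurableSet_Ioi,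
      hset, integral_smul_const, ← integral_Ioc_eq_integral_Ioo,
      ← intervalIntegral.integral_of_le hs'.2.le,
      intervalIntegral.integral_deriv_eq_sub (fun x _ => (hη.differentiable (by simp)) x)
        (hη'c.intervalIntegrable _ _), hηT, zero_sub, neg_smul]
  rw [setIntegral_congr_fun measurableSet_Ioo e1, ← integral_neg,
    ← setIntegral_congr_fun measurableSet_Ioo e2]
  exact integral_integral_swap hint

/-- A function with an integrable weak derivative on `(0, T)` is a.e. an indefinite integral of
it. -/
theorem exists_ae_eq_add_integral {T : ℝ} (hT : 0 < T) {u v : ℝ → E}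
    (hu : IntegrableOn u (Set.Ioo 0 T)) (hv : IntegrableOn v (Set.Ioo 0 T))
    (h : ∀ η : ℝ → ℝ, ContDiff ℝ ∞ η → HasCompactSupport η → tsupport η ⊆ Set.Ioo 0 T →
      ∫ t in Set.Ioo 0 T, deriv η t • u t = -∫ t in Set.Ioo 0 T, η t • v t) :
    ∃ c, ∀ᵐ t ∂(volume.restrict (Set.Ioo 0 T)), u t = c + ∫ s in (0 : ℝ)..t, v s := by
  have hvi : IntervalIntegrable v volume 0 T :=
    (intervalIntegrable_iff_integrableOn_Ioo_of_le hT.le).2 hv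
  have hVc : ContinuousOn (fun t => ∫ s in (0 : ℝ)..t, v s) (Set.Icc 0 T) := by
    have := intervalIntegral.continuousOn_primitive_interval (μ := volume) (f := v) (a := 0)
      (b := T) (by rw [Set.uIcc_of_le hT.le]; exact (integrableOn_Icc_iff_integrableOn_Ioo).2 hv)
    rwa [Set.uIcc_of_le hT.le] at this
  have hVi : IntegrableOn (fun t => ∫ s in (0 : ℝ)..t, v s) (Set.Ioo 0 T) :=
    hVc.integrableOn_Icc.mono_set Set.Ioo_subset_Icc_self
  obtain ⟨c, hc⟩ := exists_ae_eq_const_of_integral_deriv_smul_eq_zero hT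
    (w := fun t => u t - ∫ s in (0 : ℝ)..t, v s) (hu.sub hVi) fun η hη hηc hs => by
      have hi : ∀ f : ℝ → E, IntegrableOn f (Set.Ioo 0 T) →
          Integrable (fun t => deriv η t • f t) (volume.restrict (Set.Ioo 0 T)) := fun f hf =>
        (Integrable.locallyIntegrable hf).integrable_smul_left_of_hasCompactSupport
          (hη.continuous_deriv (by simp)) hηc.deriv
      simp only [smul_sub]
      rw [integral_sub (hi u hu) (hi _ hVi), h η hη hηc hs,
        integral_deriv_smul_integral_eq_neg hv hη hs, sub_self]
  refine ⟨c, ?_⟩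
  filter_upwards [hc] with t ht
  rw [← ht, sub_add_cancel]

end WeakTimeDerivative

/-! ### Consistency errors of the time discretization -/

section Consistency

/-- Cauchy–Schwarz, from the nonnegativity of the variance of `f` on the interval. -/
lemma sq_integral_le {f : ℝ → ℝ} {a b : ℝ} (hab : a < b) (hf : IntervalIntegrable f volume a b)
    (hf2 : IntervalIntegrable (fun t => f t ^ 2) volume a b) :
    (∫ t in a..b, f t) ^ 2 ≤ (b - a) * ∫ t in a..b, f t ^ 2 := by
  set I := ∫ t in a..b, f t with hI
  have hba : 0 < b - a := sub_pos.2 hab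
  have h0 : 0 ≤ ∫ t in a..b, (f t - I / (b - a)) ^ 2 :=
    intervalIntegral.integral_nonneg hab.le fun t _ => sq_nonneg _
  have h1 : ∫ t in a..b, (f t - I / (b - a)) ^ 2 =
      (∫ t in a..b, f t ^ 2) - I ^ 2 / (b - a) := by
    have e : ∀ t, (f t - I / (b - a)) ^ 2 =
        f t ^ 2 - 2 * (I / (b - a)) * f t + (I / (b - a)) ^ 2 := fun t => by ring
    simp only [e]
    rw [intervalIntegral.integral_add (hf2.sub (hf.const_mul _)) intervalIntegrable_const,
      intervalIntegral.integral_sub hf2 (hf.const_mul _), intervalIntegral.integral_const_mul,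
      intervalIntegral.integral_const, ← hI, smul_eq_mul]
    field_simp
    ring
  rw [h1, sub_nonneg, div_le_iff₀ hba] at h0
  linarith

lemma intervalIntegrable_of_Ioo {F : Type*} [NormedAddCommGroup F] {v : ℝ → F}
    {T : ℝ} (hv : IntegrableOn v (Set.Ioo 0 T)) {a b : ℝ} (ha : 0 ≤ a) (hab : a ≤ b)
    (hb : b ≤ T) : IntervalIntegrable v volume a b :=
  (intervalIntegrable_iff_integrableOn_Ioo_of_le hab).2
    (hv.mono_set (Set.Ioo_subset_Ioo ha hb))

variable {E : Type*} [NormedAddCommGroup E] [NormedSpace ℝ E] [CompleteSpace E]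

/-- If `Q` is continuous on `[0, T]` with square integrable weak derivatives `Qt` and `Qtt`, then
`Qt` has a continuous representative `P`, and the backward difference quotients of `Q` approximate
`P` to first order. -/
lemma exists_continuousOn_ae_eq_of_weakDeriv {T : ℝ} (hT : 0 < T) {Q Qt Qtt : ℝ → E}
    (hQ : ContinuousOn Q (Set.Icc 0 T))
    (hQt : MemLp Qt 2 (volume.restrict (Set.Ioo 0 T)))
    (hQtt : MemLp Qtt 2 (volume.restrict (Set.Ioo 0 T)))
    (h1 : ∀ η : ℝ → ℝ, ContDiff ℝ ∞ η → HasCompactSupport η → tsupport η ⊆ Set.Ioo 0 T →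
      ∫ t in Set.Ioo 0 T, deriv η t • Q t = -∫ t in Set.Ioo 0 T, η t • Qt t)
    (h2 : ∀ η : ℝ → ℝ, ContDiff ℝ ∞ η → HasCompactSupport η → tsupport η ⊆ Set.Ioo 0 T →
      ∫ t in Set.Ioo 0 T, deriv η t • Qt t = -∫ t in Set.Ioo 0 T, η t • Qtt t) :
    ∃ P : ℝ → E, ContinuousOn P (Set.Icc 0 T) ∧
      (∀ᵐ t ∂(volume.restrict (Set.Ioo 0 T)), Qt t = P t) ∧
      ∀ a b, 0 ≤ a → a < b → b ≤ T →
        ‖Q b - Q a‖ ^ 2 ≤ (b - a) * ∫ t in a..b, ‖Qt t‖ ^ 2 ∧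
        ‖P b - (b - a)⁻¹ • (Q b - Q a)‖ ^ 2 ≤ (b - a) * ∫ t in a..b, ‖Qtt t‖ ^ 2 := by
  have hprim : ∀ v : ℝ → E, IntegrableOn v (Set.Ioo 0 T) →
      ContinuousOn (fun t => ∫ s in (0 : ℝ)..t, v s) (Set.Icc 0 T) := fun v hv => by
    have := intervalIntegral.continuousOn_primitive_interval (μ := volume) (f := v) (a := 0)
      (b := T) (by rw [Set.uIcc_of_le hT.le]; exact (integrableOn_Icc_iff_integrableOn_Ioo).2 hv)
    rwa [Set.uIcc_of_le hT.le] at this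
  have hQti : IntegrableOn Qt (Set.Ioo 0 T) := hQt.integrable one_le_two
  have hQtti : IntegrableOn Qtt (Set.Ioo 0 T) := hQtt.integrable one_le_two
  obtain ⟨q, hq⟩ := exists_ae_eq_add_integral hT
    (hQ.integrableOn_Icc.mono_set Set.Ioo_subset_Icc_self) hQti h1
  obtain ⟨p, hp⟩ := exists_ae_eq_add_integral hT hQti hQtti h2
  -- Continuity upgrades the a.e. identity to all of `[0, T]`, endpoints included, so that it may be
  -- used at the grid times.
  have hQeq : Set.EqOn Q (fun t => q + ∫ s in (0 : ℝ)..t, Qt s) (Set.Icc 0 T) := by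
    refine Measure.eqOn_Icc_of_ae_eq volume hT.ne ?_ hQ (continuousOn_const.add (hprim _ hQti))
    rw [← Measure.restrict_congr_set Ioo_ae_eq_Icc]
    exact hq
  set P : ℝ → E := fun t => p + ∫ s in (0 : ℝ)..t, Qtt s with hP
  have hPc : ContinuousOn P (Set.Icc 0 T) := continuousOn_const.add (hprim _ hQtti)
  refine ⟨P, hPc, hp, fun a b ha hab hb => ?_⟩
  have hba : 0 < b - a := sub_pos.2 hab
  have hQdiff : Q b - Q a = ∫ t in a..b, Qt t := by
    rw [hQeq ⟨ha.trans hab.le, hb⟩, hQeq ⟨ha, hab.le.trans hb⟩, add_sub_add_left_eq_sub,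
      intervalIntegral.integral_interval_sub_left
        (intervalIntegrable_of_Ioo hQti le_rfl (ha.trans hab.le) hb)
        (intervalIntegrable_of_Ioo hQti le_rfl ha (hab.le.trans hb))]
  have hCS : ∀ v : ℝ → E, MemLp v 2 (volume.restrict (Set.Ioo 0 T)) →
      (∫ t in a..b, ‖v t‖) ^ 2 ≤ (b - a) * ∫ t in a..b, ‖v t‖ ^ 2 := fun v hv =>
    sq_integral_le hab
      (intervalIntegrable_of_Ioo (v := fun t => ‖v t‖) (hv.norm.integrable one_le_two) ha hab.le hb)
      (intervalIntegrable_of_Ioo (v := fun t => ‖v t‖ ^ 2) hv.norm.integrable_sq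
        ha hab.le hb)
  constructor
  · rw [hQdiff]
    exact (pow_le_pow_left₀ (norm_nonneg _)
      (intervalIntegral.norm_integral_le_integral_norm hab.le) 2).trans (hCS _ hQt)
  · have hPi : IntervalIntegrable P volume a b :=
      intervalIntegrable_of_Ioo (hPc.integrableOn_Icc.mono_set Set.Ioo_subset_Icc_self)
        ha hab.le hb
    have hQdiff' : Q b - Q a = ∫ t in a..b, P t := by
      rw [hQdiff, intervalIntegral.integral_of_le hab.le, intervalIntegral.integral_of_le hab.le,
        integral_Ioc_eq_integral_Ioo, integral_Ioc_eq_integral_Ioo]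
      exact integral_congr_ae (ae_restrict_of_ae_restrict_of_subset (Set.Ioo_subset_Ioo ha hb) hp)
    -- The error is the mean of `P b - P t` over the step, and each such increment is at most `∫
    -- ‖Qtt‖`.
    have hτ : P b - (b - a)⁻¹ • (Q b - Q a) = (b - a)⁻¹ • ∫ t in a..b, (P b - P t) := by
      rw [intervalIntegral.integral_sub intervalIntegrable_const hPi,
        intervalIntegral.integral_const, ← hQdiff', smul_sub _ ((b - a) • P b), smul_smul,
        inv_mul_cancel₀ hba.ne', one_smul]
    have hbound : ∀ t ∈ Set.uIoc a b, ‖P b - P t‖ ≤ ∫ s in a..b, ‖Qtt s‖ := fun t ht => by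
      rw [Set.uIoc_of_le hab.le] at ht
      have h0t : 0 ≤ t := ha.trans ht.1.le
      have e : P b - P t = ∫ s in t..b, Qtt s := by
        rw [hP]
        simp only
        rw [add_sub_add_left_eq_sub,
          intervalIntegral.integral_interval_sub_left
            (intervalIntegrable_of_Ioo hQtti le_rfl (ha.trans hab.le) hb)
            (intervalIntegrable_of_Ioo hQtti le_rfl h0t (ht.2.trans hb))]
      rw [e]
      refine (intervalIntegral.norm_integral_le_integral_norm ht.2).trans ?_
      exact intervalIntegral.integral_mono_interval ht.1.le ht.2 le_rfl
        (Eventually.of_forall fun s => norm_nonneg _)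
        (intervalIntegrable_of_Ioo hQtti.norm ha hab.le hb)
    have hn : ‖P b - (b - a)⁻¹ • (Q b - Q a)‖ ≤ ∫ s in a..b, ‖Qtt s‖ := by
      rw [hτ, norm_smul, norm_inv, Real.norm_of_nonneg hba.le, inv_mul_le_iff₀ hba, mul_comm]
      have := intervalIntegral.norm_integral_le_of_norm_le_const hbound
      rwa [abs_of_pos hba] at this
    exact (pow_le_pow_left₀ (norm_nonneg _) hn 2).trans (hCS _ hQtt)

end Consistency

/-! ### Energy inequality and discrete Gronwall argument -/

section ErrorEstimate

/-- One step of the energy estimate for an implicit scheme with consistency errors `σ` and `τ`. -/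
lemma energy_step {H : Type*} [NormedAddCommGroup H] [InnerProductSpace ℝ H] {c δ A B : ℝ}
    (hc : 0 < c) (hδ : 0 < δ) {e e' σ τ : H}
    (h : 0 ≤ inner ℝ (c • (e + σ) - δ⁻¹ • (e' - e) + τ) e')
    (hσ : ‖σ‖ ^ 2 ≤ δ * A) (hτ : ‖τ‖ ^ 2 ≤ δ * B) :
    ‖e'‖ ^ 2 * (1 - (2 * c + 1) * δ) ≤
      ‖e‖ ^ 2 * (1 + c * δ) + δ ^ 2 * (c * A + B) := by
  have young : ∀ x y : H, inner ℝ x y ≤ (‖x‖ ^ 2 + ‖y‖ ^ 2) / 2 := fun x y => by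
    have := norm_sub_sq_real x y
    nlinarith [sq_nonneg ‖x - y‖]
  have h1 := mul_nonneg hδ.le h
  have e1 : δ * inner ℝ (c • (e + σ) - δ⁻¹ • (e' - e) + τ) e' =
      δ * (c * (inner ℝ e e' + inner ℝ σ e') + inner ℝ τ e') - ‖e'‖ ^ 2 + inner ℝ e e' := by
    simp only [inner_add_left, inner_sub_left, real_inner_smul_left, real_inner_self_eq_norm_sq]
    field_simp
    ring
  rw [e1] at h1
  have y1 := young e e'
  have y2 := mul_le_mul_of_nonneg_left (young e e') (mul_pos hδ hc).le
  have y3 := mul_le_mul_of_nonneg_left (young σ e') (mul_pos hδ hc).le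
  have y4 := mul_le_mul_of_nonneg_left (young τ e') hδ.le
  have y5 := mul_le_mul_of_nonneg_left hσ (mul_pos hδ hc).le
  have y6 := mul_le_mul_of_nonneg_left hτ hδ.le
  nlinarith

/-- A discrete Gronwall step. -/
lemma le_exp_mul_add {c δ a a' b : ℝ} (hc : 0 < c) (hδ : 0 < δ) (hC : 3 * (1 + c) * δ < 1)
    (ha : 0 ≤ a) (hb : 0 ≤ b) (h : a' * (1 - (2 * c + 1) * δ) ≤ a * (1 + c * δ) + b) :
    a' ≤ Real.exp (3 * (1 + c) * δ / (1 - 3 * (1 + c) * δ)) * (a + b) := by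
  set x := 3 * (1 + c) * δ with hx
  have hx1 : 0 < 1 - x := by linarith
  have hcδ : 0 < c * δ := mul_pos hc hδ
  have hx0 : 0 < x := by positivity
  set y := (2 * c + 1) * δ with hy
  have hy1 : 0 < 1 - y := by nlinarith
  have hy0 : 0 < y := by positivity
  -- The growth factor `(1 + cδ) / (1 - y)` is at most `1 / (1 - x)`, since `cδ + y = (3c + 1)δ ≤
  -- x`; this is where the constant 3 comes from.
  have hcx : (1 + c * δ) * (1 - x) ≤ 1 - y := by nlinarith [mul_pos hcδ hx0]
  have key : a' * (1 - x) ≤ a + b := by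
    refine le_of_mul_le_mul_right ?_ hy1
    have h1 := mul_le_mul_of_nonneg_right h hx1.le
    have h2 := mul_le_mul_of_nonneg_left hcx ha
    have h3 : b * (1 - x) ≤ b * (1 - y) :=
      mul_le_mul_of_nonneg_left (by nlinarith) hb
    nlinarith
  have hE : (1 - x)⁻¹ ≤ Real.exp (x / (1 - x)) := by
    have := Real.add_one_le_exp (x / (1 - x))
    have e : x / (1 - x) + 1 = (1 - x)⁻¹ := by field_simp; ring
    rwa [e] at this
  calc a' ≤ (1 - x)⁻¹ * (a + b) := by
        rw [← div_eq_inv_mul, le_div_iff₀ hx1]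
        exact key
    _ ≤ _ := mul_le_mul_of_nonneg_right hE (add_nonneg ha hb)

end ErrorEstimate

end QTensor

end

/-! ### The first-order error bound -/

theorem theorem3p2 :
    ∃ K : ℝ, 0 < K ∧
      ∀ (d : ℕ), d = 2 ∨ d = 3 →
      ∀ (Ω : Set (QTensor.Space d)), IsOpen Ω → Bornology.IsBounded Ω →
      ∀ (c02 c21 c22 : ℝ), 0 < c02 → 0 < c21 → 0 < c21 + c22 →
      ∀ (G : QTensor.L2 Ω), QTensor.MemH1 Ω G →
      ∀ (T : ℝ), 0 < T →
      -- the solution of the gradient flow and its two time derivatives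
      ∀ (Q Qt Qtt : ℝ → QTensor.L2 Ω),
        ContinuousOn Q (Set.Icc 0 T) →
        QTensor.HasWeakTimeDeriv Ω T Q Qt →
        QTensor.HasWeakTimeDeriv Ω T Qt Qtt →
        MemLp Qt 2 (volume.restrict (Set.Ioo 0 T)) →
        MemLp Qtt 2 (volume.restrict (Set.Ioo 0 T)) →
        QTensor.IsGradientFlow Ω G c02 c21 c22 T Q Qt →
      -- the solution of the scheme, started at the same initial datum
      ∀ (δt : ℝ), 0 < δt →
      ∀ (N : ℕ), N * δt ≤ T →
      ∀ (Qn : ℕ → QTensor.L2 Ω),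
        Qn 0 = Q 0 →
        (∀ n < N, QTensor.SchemeStep Ω G c02 c21 c22 δt (Qn n) (Qn (n + 1))) →
      ∀ (C : ℝ), C = K * (1 + c02) → C * δt < 1 →
      ∀ n ≤ N,
        ‖Qn n - Q (n * δt)‖ ^ 2 ≤
          C * Real.exp (C * (n * δt) / (1 - C * δt)) * δt ^ 2 *
            ∫ t in Set.Ioo 0 (n * δt), (‖Qt t‖ ^ 2 + ‖Qtt t‖ ^ 2) := by
  refine ⟨3, by norm_num, ?_⟩
  intro d _ Ω hΩ _ c02 c21 c22 hc02 hc21 hc22 G _ T hT Q Qt Qtt hQ hQt hQtt hQt2 hQtt2 hflow δt hδ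
    N hN Qn hQ0 hstep C hC hCδ
  obtain ⟨P, hPc, hP, hcons⟩ :=
    QTensor.exists_continuousOn_ae_eq_of_weakDeriv hT hQ hQt2 hQtt2 hQt hQtt
  have hmono : ∀ n < N, ∀ s ∈ Set.Icc 0 T,
      0 ≤ inner ℝ ((c02 • Qn n - δt⁻¹ • (Qn (n + 1) - Qn n)) - (c02 • Q s - P s))
        (Qn (n + 1) - Q s) := by
    intro n hn
    set g : ℝ → ℝ := fun s => inner ℝ
      ((c02 • Qn n - δt⁻¹ • (Qn (n + 1) - Qn n)) - (c02 • Q s - P s)) (Qn (n + 1) - Q s) with hg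
    have hgc : ContinuousOn g (Set.Icc 0 T) :=
      (continuousOn_const.sub ((hQ.const_smul c02).sub hPc)).inner (continuousOn_const.sub hQ)
    -- Nonnegativity a.e. is phrased as equality of two continuous functions, which then holds
    -- everywhere.
    have hgae : g =ᵐ[volume.restrict (Set.Icc 0 T)] fun s => max (g s) 0 := by
      rw [← Measure.restrict_congr_set Ioo_ae_eq_Icc]
      filter_upwards [hflow, hP] with s hs hPs
      rw [hPs] at hs
      exact (max_eq_left ((hstep n hn).2.inner_sub_nonneg hΩ hc21.le hc22.le hs.2
        (hstep n hn).1 hs.1)).symm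
    have heq := Measure.eqOn_Icc_of_ae_eq volume hT.ne hgae hgc (hgc.sup continuousOn_const)
    intro s hs
    change 0 ≤ g s
    rw [heq hs]
    exact le_max_right _ _
  have hint : IntegrableOn (fun t => ‖Qt t‖ ^ 2 + ‖Qtt t‖ ^ 2) (Set.Ioo 0 T) :=
    hQt2.norm.integrable_sq.add hQtt2.norm.integrable_sq
  set x := C * δt with hx
  have hC0 : 0 < C := by rw [hC]; positivity
  have hexp : 1 ≤ Real.exp (x / (1 - x)) :=
    Real.one_le_exp (div_nonneg (mul_pos hC0 hδ).le (by linarith))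
  have main : ∀ n ≤ N, ‖Qn n - Q (n * δt)‖ ^ 2 ≤ Real.exp (x / (1 - x)) ^ n *
      (δt ^ 2 * (1 + c02)) * ∫ t in (0 : ℝ)..(n * δt), (‖Qt t‖ ^ 2 + ‖Qtt t‖ ^ 2) := by
    intro n
    induction n with
    | zero => intro _; simp [hQ0]
    | succ n ih =>
      intro hn
      have ih := ih (Nat.le_of_succ_le hn)
      set a : ℝ := n * δt with ha
      set b : ℝ := ((n + 1 : ℕ) : ℝ) * δt with hb
      have hba : b - a = δt := by rw [ha, hb]; push_cast; ring
      have ha0 : 0 ≤ a := by positivity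
      have hab : a < b := by linarith
      have hbT : b ≤ T := le_trans (by rw [hb]; gcongr) hN
      obtain ⟨hσ, hτ⟩ := hcons a b ha0 hab hbT
      rw [hba] at hσ hτ
      rw [norm_sub_rev] at hσ
      have hm := hmono n hn b ⟨ha0.trans hab.le, hbT⟩
      -- The residual in terms of the old and new errors, the lag `Q a - Q b` of the explicit term,
      -- and the error of the difference quotient.
      have e : (c02 • Qn n - δt⁻¹ • (Qn (n + 1) - Qn n)) - (c02 • Q b - P b) =
          c02 • ((Qn n - Q a) + (Q a - Q b)) -
            δt⁻¹ • ((Qn (n + 1) - Q b) - (Qn n - Q a)) + (P b - δt⁻¹ • (Q b - Q a)) := by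
        module
      rw [e] at hm
      have hA : 0 ≤ ∫ t in a..b, ‖Qt t‖ ^ 2 :=
        intervalIntegral.integral_nonneg hab.le fun t _ => by positivity
      have hB : 0 ≤ ∫ t in a..b, ‖Qtt t‖ ^ 2 :=
        intervalIntegral.integral_nonneg hab.le fun t _ => by positivity
      have hstep1 := QTensor.energy_step hc02 hδ hm hσ hτ
      have hg := QTensor.le_exp_mul_add hc02 hδ (by rwa [hx, hC] at hCδ) (sq_nonneg _)
        (by positivity) hstep1
      rw [← hC, ← hx] at hg
      have hAB : ∫ t in a..b, (‖Qt t‖ ^ 2 + ‖Qtt t‖ ^ 2) =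
          (∫ t in a..b, ‖Qt t‖ ^ 2) + ∫ t in a..b, ‖Qtt t‖ ^ 2 :=
        intervalIntegral.integral_add
          (QTensor.intervalIntegrable_of_Ioo (v := fun t => ‖Qt t‖ ^ 2)
            hQt2.norm.integrable_sq ha0 hab.le hbT)
          (QTensor.intervalIntegrable_of_Ioo (v := fun t => ‖Qtt t‖ ^ 2)
            hQtt2.norm.integrable_sq ha0 hab.le hbT)
      rw [← intervalIntegral.integral_add_adjacent_intervals
        (QTensor.intervalIntegrable_of_Ioo hint le_rfl ha0 (hab.le.trans hbT))
        (QTensor.intervalIntegrable_of_Ioo hint ha0 hab.le hbT), hAB]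
      set A := ∫ t in a..b, ‖Qt t‖ ^ 2
      set B := ∫ t in a..b, ‖Qtt t‖ ^ 2
      set I := ∫ t in (0 : ℝ)..a, (‖Qt t‖ ^ 2 + ‖Qtt t‖ ^ 2)
      set E := Real.exp (x / (1 - x))
      have hE0 : 0 < E := Real.exp_pos _
      -- As `E ≥ 1`, the new source may carry the factor `E ^ n` already attached to the old ones,
      -- so the integrals over successive steps add up.
      have h1 : δt ^ 2 * (c02 * A + B) ≤ E ^ n * (δt ^ 2 * (1 + c02)) * (A + B) := by
        have h2 : c02 * A + B ≤ (1 + c02) * (A + B) := by nlinarith [mul_nonneg hc02.le hB]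
        have h3 : δt ^ 2 * (c02 * A + B) ≤ δt ^ 2 * (1 + c02) * (A + B) := by
          rw [mul_assoc]
          exact mul_le_mul_of_nonneg_left h2 (by positivity)
        have h4 : 1 * (δt ^ 2 * (1 + c02) * (A + B)) ≤ E ^ n * (δt ^ 2 * (1 + c02) * (A + B)) :=
          mul_le_mul_of_nonneg_right (one_le_pow₀ hexp) (by positivity)
        linarith
      calc _ ≤ E * (‖Qn n - Q a‖ ^ 2 + δt ^ 2 * (c02 * A + B)) := hg
        _ ≤ E * (E ^ n * (δt ^ 2 * (1 + c02)) * I + E ^ n * (δt ^ 2 * (1 + c02)) * (A + B)) := by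
          gcongr
        _ = _ := by ring
  intro n hn
  have h := main n hn
  rw [← Real.exp_nat_mul, intervalIntegral.integral_of_le (by positivity),
    integral_Ioc_eq_integral_Ioo] at h
  have e : (n : ℝ) * (x / (1 - x)) = C * (n * δt) / (1 - x) := by rw [hx]; ring
  rw [e] at h
  refine h.trans ?_
  refine mul_le_mul_of_nonneg_right ?_ (integral_nonneg fun t => by positivity)
  have h5 : 1 + c02 ≤ C := by rw [hC]; linarith
  calc Real.exp (C * (n * δt) / (1 - x)) * (δt ^ 2 * (1 + c02))
      ≤ Real.exp (C * (n * δt) / (1 - x)) * (δt ^ 2 * C) := by gcongr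
    _ = _ := by ring
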